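/- \textbf{Lemma.} Let $n\ge 2$, $\lambda=\frac{n-1}{2}$, and let $\sigma$ be the surface measure on the unit sphere $\mathcal S^n\subset\mathbb R^{n+1}$, $\hat e=(1,0,\dots,0)$. Let $C_l^\lambda$ be the Gegenbauer polynomials, $\sum_{l\ge0}C_l^\lambda(t)r^l=(1-2tr+r^2)^{-\lambda}$. Let $f\in\mathcal L^2(\mathcal S^n)$, $f\neq0$, be a complex-valued zonal function, $f(x)=F(\langle\hat e,x\rangle)$, with Gegenbauer coefficients $$\widehat f(l)=\frac{\int_{-1}^1F(t)\,C_l^\lambda(t)(1-t^2)^{\lambda-1/2}\,dt}{\int_{-1}^1C_l^\lambda(t)^2(1-t^2)^{\lambda-1/2}\,dt}.$$ Then $f=\sum_{l=0}^\infty\widehat f(l)\,C_l^\lambda(\langle\hat e,\cdot\rangle)$ in $\mathcal L^2(\mathcal S^n)$. Put $$A=\sum_{l=0}^\infty\frac{\lambda}{l+\lambda}\binom{l+2\lambda-1}{l}|\widehat f(l)|^2,\qquad D=\sum_{l=0}^\infty\binom{l+2\lambda}{l}\frac{\lambda^2\left[\overline{\widehat f(l)}\,\widehat f(l+1)+\widehat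 f(l)\,\overline{\widehat f(l+1)}\right]}{(l+\lambda)(l+\lambda+1)},$$ $$M=\sum_{l=1}^\infty\frac{l\lambda(l+2\lambda)}{l+\lambda}\binom{l+2\lambda-1}{l}|\widehat f(l)|^2 .$$ The series $A$ and $D$ converge absolutely, and $A>0$. (i) If $\int_{\mathcal S^n}x\,|f(x)|^2\,d\sigma(x)\ne0$, then $D\neq0$, and the space variance $\mathrm{var}_S(f)=\left(\frac{\int_{\mathcal S^n}|f|^2d\sigma}{\int_{\mathcal S^n}x|f(x)|^2d\sigma(x)}\right)^2-1$ (the square of the vector in the denominator being its squared Euclidean norm) equals $$\mathrm{var}_S(f)=\left(\frac AD\right)^2-1 .$$ (ii) Let $\mathrm{var}_M(f)=-\frac{\int_{\mathcal S^n}\Delta^*f\cdot\bar f\,d\sigma}{\int_{\mathcal S^n}|f|^2d\sigma}$ be the momentum variance, where $\Delta^*$ is the Laplace--Beltrami operator on $\mathcal S^n$ and where, for $f$ that is not of class $\mathcal C^2$, the numerator is understood as the value at $f$ of the closure in $\mathcal L^2(\mathcal S^n)$ of the quadratic form $\varphi\mapsto-\int_{\mathcal S^n}\Delta^*\varphi\cdot\bar\varphi\,d\sigma$,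 $\varphi\in\mathcal C^2(\mathcal S^n)$. If the series $M$ converges, then $f$ belongs to the domain of the closed form, the value of the form at $f$ is unique, and $$\mathrm{var}_M(f)=\frac MA .$$ If $f\in\mathcal C^2(\mathcal S^n)$, then the series $M$ converges, and this formula holds for the classical $\mathrm{var}_M(f)$. -/

import Mathlib

open MeasureTheory Filter Topology
open scoped ComplexConjugate Manifold ContDiff

noncomputable section

namespace SphereVariance

/-- Euclidean space `ℝ^{n+1}`. -/
abbrev Euc (n : ℕ) : Type := EuclideanSpace ℝ (Fin (n + 1))

/-- The unit sphere `S^n` in `ℝ^{n+1}`. -/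
abbrev Sph (n : ℕ) : Type := Metric.sphere (0 : Euc n) 1

/-- The surface measure `σ` on `S^n` (rotation invariant, with total mass
`2 π^{(n+1)/2} / Γ((n+1)/2)`). -/
def surf (n : ℕ) : Measure (Sph n) := (volume : Measure (Euc n)).toSphere

/-- The index `λ = (n - 1) / 2` attached to the dimension `n` of the sphere. -/
def lam (n : ℕ) : ℝ := ((n : ℝ) - 1) / 2

/-- The Gegenbauer polynomial `C_l^μ(t)`: the coefficient of `r^l` in the expansion at `r = 0` of
the generating function `(1 - 2 t r + r²)^{-μ}`. -/
def gegenbauer (μ : ℝ) (l : ℕ) (t : ℝ) : ℝ :=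
  iteratedDeriv l (fun r : ℝ => (1 - 2 * t * r + r ^ 2) ^ (-μ)) 0 / (l.factorial : ℝ)

/-- The zonal function on `S^n` with profile `F`: `x ↦ F(⟨ê, x⟩)`, where `ê = (1, 0, …, 0)`. -/
def zonal (n : ℕ) (F : ℝ → ℂ) : Sph n → ℂ :=
  fun x => F (inner ℝ (EuclideanSpace.single (0 : Fin (n + 1)) (1 : ℝ)) (x : Euc n))

/-- The Gegenbauer coefficient `f̂(l)` of the zonal function on `S^n` with profile `F`. -/
def gegenbauerCoeff (n : ℕ) (F : ℝ → ℂ) (l : ℕ) : ℂ :=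
  ((∫ t in (-1 : ℝ)..1, gegenbauer (lam n) l t ^ 2 * (1 - t ^ 2) ^ (lam n - 1 / 2) : ℝ) : ℂ)⁻¹ *
    ∫ t in (-1 : ℝ)..1,
      F t * (gegenbauer (lam n) l t : ℂ) * (((1 - t ^ 2) ^ (lam n - 1 / 2) : ℝ) : ℂ)

/-- `f` is of class `C²` on the manifold `S^n`. -/
def IsC2 {n : ℕ} (f : Sph n → ℂ) : Prop := ContMDiff (𝓡 n) 𝓘(ℝ, ℂ) 2 f

/-- The extension of `f : S^n → ℂ` to `ℝ^{n+1}` that is constant on the rays from the origin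
(with value `0` at the origin). -/
def radialExt {n : ℕ} (f : Sph n → ℂ) (y : Euc n) : ℂ :=
  if h : y = 0 then 0
  else f ⟨‖y‖⁻¹ • y, by simp [norm_smul, h]⟩

/-- The Laplace–Beltrami operator `Δ*` of `S^n`: the restriction to `S^n` of the Laplacian of the
extension that is constant along rays. -/
def laplaceBeltrami {n : ℕ} (f : Sph n → ℂ) (x : Sph n) : ℂ :=
  Laplacian.laplacian (radialExt f) (x : Euc n)

/-- The vector `∫ x |f(x)|² dσ(x)`. -/
def moment {n : ℕ} (f : Sph n → ℂ) : Euc n := ∫ x, ‖f x‖ ^ 2 • (x : Euc n) ∂(surf n)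

/-- The space variance `(∫ |f|² dσ / ∫ x |f|² dσ)² - 1`; the square of the vector in the
denominator is its squared Euclidean norm. -/
def varS {n : ℕ} (f : Sph n → ℂ) : ℝ := ((∫ x, ‖f x‖ ^ 2 ∂(surf n)) / ‖moment f‖) ^ 2 - 1

/-- The quadratic form `- ∫ Δ*φ · conj φ dσ`, meaningful for `φ` of class `C²`. -/
def lbForm {n : ℕ} (φ : Sph n → ℂ) : ℂ := -∫ x, laplaceBeltrami φ x * conj (φ x) ∂(surf n)

/-- The momentum variance of a function of class `C²`. -/
def varM {n : ℕ} (f : Sph n → ℂ) : ℂ := lbForm f / ((∫ x, ‖f x‖ ^ 2 ∂(surf n) : ℝ) : ℂ)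

/-- `f` lies in the domain of the closure of the quadratic form `- ∫ Δ*φ · conj φ dσ`, `φ ∈ C²`,
on `L²(S^n)` (that is, `f` is in the Sobolev space `H¹(S^n)`), and the closed form takes the value
`q` at `f`. -/
def HasLBForm {n : ℕ} (f : Sph n → ℂ) (q : ℂ) : Prop :=
  ∃ φ : ℕ → Sph n → ℂ, (∀ k, IsC2 (φ k)) ∧
    Tendsto (fun k => eLpNorm (φ k - f) 2 (surf n)) atTop (𝓝 0) ∧
    Tendsto (fun p : ℕ × ℕ => lbForm (φ p.1 - φ p.2)) atTop (𝓝 0) ∧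
    Tendsto (fun k => lbForm (φ k)) atTop (𝓝 q)

/-- `f ∈ L²(S^n)` has the momentum variance `v`, where `- ∫ Δ*f · conj f dσ` is understood
through the closure of this form from `C²(S^n)`. -/
def HasVarM {n : ℕ} (f : Sph n → ℂ) (v : ℂ) : Prop :=
  ∃ q : ℂ, HasLBForm f q ∧ v = q / ((∫ x, ‖f x‖ ^ 2 ∂(surf n) : ℝ) : ℂ)

/-- For a function of class `C²` the closed form takes its classical value. -/
theorem IsC2.hasVarM {n : ℕ} {f : Sph n → ℂ} (hf : IsC2 f) : HasVarM f (varM f) := by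
  refine ⟨lbForm f, ⟨fun _ => f, fun _ => hf, ?_, ?_, tendsto_const_nhds⟩, rfl⟩
  · simp
  · simp [lbForm]

/-- `(λ / (l + λ)) binom(l + 2λ - 1, l) |a_l|²`, where `2λ = n - 1`. -/
def normTerm (n : ℕ) (a : ℕ → ℂ) (l : ℕ) : ℝ :=
  lam n / (l + lam n) * ((l + n - 2).choose l : ℝ) * ‖a l‖ ^ 2

/-- `binom(l + 2λ, l) λ² [conj a_l · a_{l+1} + a_l · conj a_{l+1}] / ((l + λ)(l + λ + 1))`,
where `2λ = n - 1`. -/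
def crossTerm (n : ℕ) (a : ℕ → ℂ) (l : ℕ) : ℂ :=
  ((l + n - 1).choose l : ℂ) *
    (((lam n : ℝ) : ℂ) ^ 2 * (conj (a l) * a (l + 1) + a l * conj (a (l + 1)))) /
    (((l : ℂ) + ((lam n : ℝ) : ℂ)) * ((l : ℂ) + ((lam n : ℝ) : ℂ) + 1))

/-- `(l λ (l + 2λ) / (l + λ)) binom(l + 2λ - 1, l) |a_l|²`, where `2λ = n - 1`. -/
def momentumTerm (n : ℕ) (a : ℕ → ℂ) (l : ℕ) : ℝ :=
  l * lam n * (l + 2 * lam n) / (l + lam n) * ((l + n - 2).choose l : ℝ) * ‖a l‖ ^ 2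

end SphereVariance

end

noncomputable section

namespace SphereVariance

/-! For zonal `f` every quantity reduces to one variable. The coordinate `⟨ê, x⟩` is distributed
under `σ` as a constant multiple of the Gegenbauer weight (`coordMeasure_eq`), and in `L²` of that
distribution the normalized Gegenbauer polynomials form a Hilbert basis (`gegBasis`). All three
series are then Parseval sums divided by the total mass of the sphere, which cancels in the
quotients. `A` is the squared norm of `F`. `D` is the inner product of `F` with `t F`, where
multiplication by `t` couples only neighbouring degrees by the three-term recurrence; the other
components of the moment vanish by reflection. `M` is the Dirichlet form, which is diagonal with
eigenvalues `l (l + 2λ)`.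

The geometric input is Green's formula on the sphere. As `Δ*` is given by the Laplacian of the
ray-constant extension, one integrates over `ℝ^{n+1}` against a radial cutoff vanishing near the
origin and integrates by parts there: the gradient of the cutoff is radial and so does not see
ray-constant functions (`integral_laplacian_mul_cutoff`). Hence the form is Hermitian and
nonnegative on `C²`. Symmetry makes eigenfunctions of different eigenvalues orthogonal. Tested
against `1`, it also gives the law of the coordinate: integration over the sphere and integration
against the weight both annihilate the range of `Δ*` on polynomials, and this range contains every
Gegenbauer polynomial of positive degree.

For the closed form, partial sums of the expansion are form-Cauchy as soon as `M` converges, which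
gives existence. Uniqueness is closability: the difference of two approximating sequences is
`L²`-null, hence weakly null for the form after `Δ*` is moved to the test function, and a
form-Cauchy weakly null sequence has energy tending to zero (`norm_sq_tendsto_of_weak`). For `f` of
class `C²`, Bessel's inequality for the form bounds the partial sums of `M`. -/

open Polynomial in
/-- The Gegenbauer polynomials, defined by their three-term recurrence. -/
def gegPoly (μ : ℝ) : ℕ → Polynomial ℝ
  | 0 => 1
  | 1 => C (2 * μ) * X
  | l + 2 => C ((l + 2 : ℝ)⁻¹) *
      (2 * ((l : ℝ[X]) + 1 + C μ) * X * gegPoly μ (l + 1) - ((l : ℝ[X]) + 2 * C μ) * gegPoly μ l)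

/-! ### Recurrence, differential equation and span of the Gegenbauer polynomials -/

section Polynomials
open Polynomial

theorem gegPoly_rec (μ : ℝ) (l : ℕ) :
    ((l : ℝ[X]) + 2) * gegPoly μ (l + 2) =
      2 * ((l : ℝ[X]) + 1 + C μ) * X * gegPoly μ (l + 1)
        - ((l : ℝ[X]) + 2 * C μ) * gegPoly μ l := by
  have h : ((l : ℝ[X]) + 2) * C ((l + 2 : ℝ)⁻¹) = 1 := by
    have : ((l : ℝ[X]) + 2) = C (l + 2 : ℝ) := by simp [map_ofNat C 2]
    rw [this, ← C_mul, mul_inv_cancel₀ (by positivity), C_1]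
  rw [gegPoly]
  linear_combination (2 * ((l : ℝ[X]) + 1 + C μ) * X * gegPoly μ (l + 1)
        - ((l : ℝ[X]) + 2 * C μ) * gegPoly μ l) * h

/-- The two identities need a joint induction: differentiating the recurrence and inserting the
first identity gives the second at the next index, and the first at the next index is then an
algebraic consequence. -/
theorem gegPoly_derivative_identities (μ : ℝ) (l : ℕ) :
    X * derivative (gegPoly μ (l + 1)) - derivative (gegPoly μ l)
        = ((l : ℝ[X]) + 1) * gegPoly μ (l + 1) ∧
    derivative (gegPoly μ (l + 1)) - X * derivative (gegPoly μ l)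
        = ((l : ℝ[X]) + 2 * C μ) * gegPoly μ l := by
  induction l with
  | zero => simp [gegPoly, map_ofNat C 2]; ring
  | succ l ih =>
    obtain ⟨ha, hb⟩ := ih
    have hne : ((l : ℝ[X]) + 2) ≠ 0 := by
      have : ((l : ℝ[X]) + 2) = C (l + 2 : ℝ) := by simp [map_ofNat C 2]
      rw [this, Ne, C_eq_zero]; positivity
    have hr := gegPoly_rec μ l
    have hd := congrArg derivative hr
    simp only [derivative_mul, derivative_add, derivative_sub, derivative_natCast, derivative_C,
      derivative_X, derivative_one, derivative_ofNat] at hd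
    have hb' : derivative (gegPoly μ (l + 2)) - X * derivative (gegPoly μ (l + 1))
        = ((l : ℝ[X]) + 1 + 2 * C μ) * gegPoly μ (l + 1) := by
      apply mul_left_cancel₀ hne
      linear_combination hd + (l + 2 * C μ) * ha
    refine ⟨?_, by push_cast; linear_combination hb'⟩
    push_cast
    linear_combination X * hb' - hr + X * ha - hb
    

/-- Eliminating the derivative of the lower polynomial from the two identities expresses `(1 - X ^
2)` times a derivative by the polynomials themselves; one more differentiation yields the equation.
-/
theorem gegPoly_ode (μ : ℝ) (l : ℕ) :
    (1 - X ^ 2) * derivative (derivative (gegPoly μ l))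
      - (2 * C μ + 1) * X * derivative (gegPoly μ l)
      + (l : ℝ[X]) * ((l : ℝ[X]) + 2 * C μ) * gegPoly μ l = 0 := by
  cases l with
  | zero => simp [gegPoly]
  | succ l =>
    obtain ⟨ha, hb⟩ := gegPoly_derivative_identities μ l
    have h : (1 - X ^ 2) * derivative (gegPoly μ (l + 1)) =
        ((l : ℝ[X]) + 2 * C μ) * gegPoly μ l - ((l : ℝ[X]) + 1) * X * gegPoly μ (l + 1) := by
      linear_combination hb - X * ha
    have hd := congrArg derivative h
    simp only [derivative_mul, derivative_add, derivative_sub, derivative_natCast, derivative_C,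
      derivative_X, derivative_one, derivative_ofNat, derivative_X_pow] at hd
    push_cast at hd ⊢
    rw [map_ofNat C 2] at hd
    linear_combination hd - (l + 2 * C μ) * ha

/-- The span contains `1` and is stable under multiplication by `X`, since the recurrence can be
solved for `X * gegPoly μ (l + 1)` when `μ > 0`. -/
theorem span_gegPoly {μ : ℝ} (hμ : 0 < μ) :
    Submodule.span ℝ (Set.range (gegPoly μ)) = ⊤ := by
  set S := Submodule.span ℝ (Set.range (gegPoly μ)) with hS
  have hG (l : ℕ) : gegPoly μ l ∈ S := Submodule.subset_span ⟨l, rfl⟩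
  have hX (p : ℝ[X]) (hp : p ∈ S) : X * p ∈ S := by
    induction hp using Submodule.span_induction with
    | zero => simp
    | add p q _ _ hp hq => rw [mul_add]; exact S.add_mem hp hq
    | smul c p _ hp => rw [mul_smul_comm]; exact S.smul_mem c hp
    | mem p hp =>
      obtain ⟨l, rfl⟩ := hp
      cases l with
      | zero =>
        have h : X * gegPoly μ 0 = (2 * μ)⁻¹ • gegPoly μ 1 := by
          rw [gegPoly, gegPoly, smul_eq_C_mul, ← mul_assoc, ← C_mul,
            inv_mul_cancel₀ (by positivity)]
          simp
        rw [h]; exact S.smul_mem _ (hG 1)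
      | succ l =>
        have h : X * gegPoly μ (l + 1) = (2 * ((l : ℝ) + 1 + μ))⁻¹ •
            ((l + 2 : ℝ) • gegPoly μ (l + 2) + (l + 2 * μ) • gegPoly μ l) := by
          rw [eq_inv_smul_iff₀ (by positivity)]
          simp only [smul_eq_C_mul, C_add, C_mul, C_1, map_natCast, map_ofNat]
          linear_combination -gegPoly_rec μ l
        rw [h]
        exact S.smul_mem _ (S.add_mem (S.smul_mem _ (hG _)) (S.smul_mem _ (hG _)))
  rw [eq_top_iff]
  rintro p -
  have hpow (k : ℕ) : (X : ℝ[X]) ^ k ∈ S := by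
    induction k with
    | zero => simpa [gegPoly] using hG 0
    | succ k ih => rw [pow_succ']; exact hX _ ih
  rw [p.as_sum_range_C_mul_X_pow]
  exact S.sum_mem fun i _ => by rw [← smul_eq_C_mul]; exact S.smul_mem _ (hpow i)

end Polynomials

/-! ### Agreement of the generating function with the recurrence -/

section GeneratingFunction

/-- The generating function satisfies the first-order equation `(1 - 2tr + r²) g' = 2μ(t - r) g`
near `r = 0`; its higher derivatives at `0` are the three-term recurrence for the Taylor
coefficients. -/
theorem gegenbauer_eq_eval (μ : ℝ) (l : ℕ) (t : ℝ) : gegenbauer μ l t = (gegPoly μ l).eval t := by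
  set U : Set ℝ := {r | 0 < 1 - 2 * t * r + r ^ 2} with hU
  have hUo : IsOpen U := isOpen_lt continuous_const (by fun_prop)
  have h0 : (0 : ℝ) ∈ U := by simp [hU]
  set g : ℝ → ℝ := fun r => (1 - 2 * t * r + r ^ 2) ^ (-μ) with hg
  have hgs : ContDiffOn ℝ ∞ g U := by
    intro r hr
    refine ContDiffAt.contDiffWithinAt (ContDiffAt.rpow_const_of_ne (by fun_prop) (ne_of_gt hr))
  have hD (k : ℕ) (r : ℝ) (hr : r ∈ U) :
      HasDerivAt (iteratedDeriv k g) (iteratedDeriv (k + 1) g r) r := by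
    have h := (hgs.differentiableOn_iteratedDerivWithin (m := k)
      (by exact_mod_cast WithTop.coe_lt_top _) hUo.uniqueDiffOn).congr
      (fun x hx => (iteratedDerivWithin_of_isOpen hUo hx).symm)
    rw [iteratedDeriv_succ]
    exact ((h r hr).differentiableAt (hUo.mem_nhds hr)).hasDerivAt
  have h1 (r : ℝ) (hr : r ∈ U) : (1 - 2 * t * r + r ^ 2) * iteratedDeriv 1 g r
      = 2 * μ * (t - r) * iteratedDeriv 0 g r := by
    have hp : HasDerivAt (fun r : ℝ => 1 - 2 * t * r + r ^ 2) (2 * r - 2 * t) r := by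
      have := (((hasDerivAt_id r).const_mul (2 * t)).const_sub 1).add ((hasDerivAt_id r).pow 2)
      refine HasDerivAt.congr_deriv (f := fun r : ℝ => 1 - 2 * t * r + r ^ 2) this ?_
      simp; ring
    have hd := hp.rpow_const (p := -μ) (Or.inl (ne_of_gt hr))
    have hr' : (1 - 2 * t * r + r ^ 2) * (1 - 2 * t * r + r ^ 2) ^ (-μ - 1)
        = (1 - 2 * t * r + r ^ 2) ^ (-μ) := by
      rw [Real.rpow_sub_one (ne_of_gt hr), mul_div_cancel₀ _ (ne_of_gt hr)]
    rw [iteratedDeriv_one, iteratedDeriv_zero, hd.deriv, hg]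
    linear_combination (2 * μ * (t - r)) * hr'
  -- This is the equation `h1` differentiated `k + 1` times by the Leibniz rule, which stops early
  -- because the coefficients have degree at most two in `r`.
  have hk (k : ℕ) : ∀ r ∈ U, (1 - 2 * t * r + r ^ 2) * iteratedDeriv (k + 2) g r
      + (k + 1) * (2 * r - 2 * t) * iteratedDeriv (k + 1) g r + k * (k + 1) * iteratedDeriv k g r
      = 2 * μ * ((t - r) * iteratedDeriv (k + 1) g r - (k + 1) * iteratedDeriv k g r) := by
    have hp (r : ℝ) : HasDerivAt (fun r : ℝ => 1 - 2 * t * r + r ^ 2) (2 * r - 2 * t) r := by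
      have := (((hasDerivAt_id r).const_mul (2 * t)).const_sub 1).add ((hasDerivAt_id r).pow 2)
      refine HasDerivAt.congr_deriv (f := fun r : ℝ => 1 - 2 * t * r + r ^ 2) this ?_
      simp; ring
    induction k with
    | zero =>
      intro r hr
      have e1 := (hp r).mul (hD 1 r hr)
      have e2 := (((hasDerivAt_id r).const_sub t).const_mul (2 * μ)).mul (hD 0 r hr)
      have := e1.unique (e2.congr_of_eventuallyEq
        (Filter.eventually_of_mem (hUo.mem_nhds hr) h1))
      simp only [id] at this
      push_cast
      linear_combination this
    | succ k ih =>
      intro r hr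
      have e1 := (((hp r).mul (hD (k + 2) r hr)).add
        (((((hasDerivAt_id r).const_mul 2).sub_const (2 * t)).const_mul (k + 1 : ℝ)).mul
          (hD (k + 1) r hr))).add ((hD k r hr).const_mul (k * (k + 1) : ℝ))
      have e2 := ((((hasDerivAt_id r).const_sub t).mul (hD (k + 1) r hr)).sub
        ((hD k r hr).const_mul (k + 1 : ℝ))).const_mul (2 * μ)
      have := e1.unique (e2.congr_of_eventuallyEq
        (Filter.eventually_of_mem (hUo.mem_nhds hr) ih))
      simp only [id] at this
      push_cast
      linear_combination this
  have hrec (k : ℕ) : ((k : ℝ) + 2) * gegenbauer μ (k + 2) t =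
      2 * ((k : ℝ) + 1 + μ) * t * gegenbauer μ (k + 1) t - (k + 2 * μ) * gegenbauer μ k t := by
    have h := hk k 0 h0
    have hf : ((k.factorial : ℕ) : ℝ) ≠ 0 := by positivity
    simp only [gegenbauer, Nat.factorial_succ, Nat.cast_mul]
    rw [← hg]
    push_cast
    field_simp
    linear_combination (k + 2 : ℝ) * h
  have key : gegenbauer μ l t = (gegPoly μ l).eval t ∧
      gegenbauer μ (l + 1) t = (gegPoly μ (l + 1)).eval t := by
    induction l with
    | zero =>
      have h := h1 0 h0
      simp only [gegenbauer, ← hg]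
      constructor
      · simp [gegPoly, hg]
      · simp only [iteratedDeriv_zero] at h
        simp [gegPoly, hg] at h ⊢
        linarith
    | succ l ih =>
      refine ⟨ih.2, ?_⟩
      have e := congrArg (Polynomial.eval t) (gegPoly_rec μ l)
      simp only [Polynomial.eval_mul, Polynomial.eval_add, Polynomial.eval_sub,
        Polynomial.eval_natCast, Polynomial.eval_C, Polynomial.eval_X, Polynomial.eval_one,
        Polynomial.eval_ofNat] at e
      have h2 : ((l : ℝ) + 2) ≠ 0 := by positivity
      apply mul_left_cancel₀ h2
      rw [show l + 1 + 1 = l + 2 from rfl, e, hrec, ih.1, ih.2]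
  exact key.1

end GeneratingFunction

/-! ### Ray-constant extensions: regularity, homogeneity, Euler's relation -/

section RadialExtension

variable {n : ℕ}

/-- The `i`-th partial derivative of a function on `ℝ^{n+1}`. -/
def partialDeriv (i : Fin (n + 1)) (Φ : Euc n → ℂ) (y : Euc n) : ℂ :=
  fderiv ℝ Φ y (EuclideanSpace.single i (1 : ℝ))

theorem radialExt_of_ne (φ : Sph n → ℂ) {y : Euc n} (hy : y ≠ 0) :
    radialExt φ y = φ ⟨‖y‖⁻¹ • y, by simp [norm_smul, hy]⟩ := by
  simp [radialExt, hy]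

theorem radialExt_coe (φ : Sph n → ℂ) (x : Sph n) : radialExt φ x = φ x := by
  have hx : (x : Euc n) ≠ 0 := ne_zero_of_mem_unit_sphere x
  rw [radialExt_of_ne φ hx]
  congr 1
  ext1
  simp

theorem radialExt_smul (φ : Sph n → ℂ) {r : ℝ} (hr : 0 < r) (y : Euc n) :
    radialExt φ (r • y) = radialExt φ y := by
  by_cases hy : y = 0
  · simp [hy]
  · rw [radialExt_of_ne φ hy, radialExt_of_ne φ (smul_ne_zero hr.ne' hy)]
    congr 2
    rw [norm_smul, smul_smul, Real.norm_of_nonneg hr.le]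
    congr 1
    field_simp

/-- Off the origin the extension is `φ` composed with `z ↦ z / ‖z‖`, which is smooth as a map from
an open submanifold into the sphere. -/
theorem IsC2.contDiffAt_radialExt {φ : Sph n → ℂ} (hφ : IsC2 φ) {y : Euc n} (hy : y ≠ 0) :
    ContDiffAt ℝ 2 (radialExt φ) y := by
  have := Fact.mk (@finrank_euclideanSpace_fin ℝ _ (n + 1))
  let U : TopologicalSpace.Opens (Euc n) := ⟨{0}ᶜ, isOpen_compl_singleton⟩
  have hg : ContMDiff 𝓘(ℝ, Euc n) 𝓘(ℝ, Euc n) 2 (fun z : U => ‖(z : Euc n)‖⁻¹ • (z : Euc n)) := by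
    intro z
    have hz : (z : Euc n) ≠ 0 := z.2
    refine (contMDiffAt_subtype_iff (f := fun z : Euc n => ‖z‖⁻¹ • z)).2 ?_
    apply ContDiffAt.contMDiffAt
    exact ((contDiffAt_norm ℝ hz).inv (norm_ne_zero_iff.2 hz)).smul contDiffAt_id
  have hg' (z : U) : ‖(z : Euc n)‖⁻¹ • (z : Euc n) ∈ Metric.sphere (0 : Euc n) 1 := by
    have hz : (z : Euc n) ≠ 0 := z.2
    simp [norm_smul, hz]
  have hc := ContMDiff.comp hφ (hg.codRestrict_sphere hg')
  have h2 : ContMDiffAt 𝓘(ℝ, Euc n) 𝓘(ℝ, ℂ) 2 (fun z : U => radialExt φ z) ⟨y, hy⟩ := by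
    refine (hc ⟨y, hy⟩).congr_of_eventuallyEq (Eventually.of_forall fun z => ?_)
    exact radialExt_of_ne φ z.2
  exact (contMDiffAt_subtype_iff.1 h2).contDiffAt

theorem laplacian_eq_sum_partialDeriv {Φ : Euc n → ℂ} {y : Euc n} (h : ContDiffAt ℝ 2 Φ y) :
    Laplacian.laplacian Φ y = ∑ i, partialDeriv i (partialDeriv i Φ) y := by
  have hd : DifferentiableAt ℝ (fderiv ℝ Φ) y :=
    (h.fderiv_right (m := 1) (by norm_num)).differentiableAt (by norm_num)
  rw [InnerProductSpace.laplacian_eq_iteratedFDeriv_orthonormalBasis Φ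
    (EuclideanSpace.basisFun (Fin (n + 1)) ℝ)]
  refine Finset.sum_congr rfl fun i _ => ?_
  rw [iteratedFDeriv_two_apply]
  simp only [EuclideanSpace.basisFun_apply, Matrix.cons_val_zero, Matrix.cons_val_one]
  unfold partialDeriv
  rw [fderiv_clm_apply hd (by fun_prop)]
  simp

/-- Used with factor `1` and then with factor `r⁻¹`, this gives the homogeneity degree `-2` of the
Laplacian of a ray-constant function. -/
theorem partialDeriv_smul_of_homogeneous {Φ : Euc n → ℂ} {r : ℝ} (hr : 0 < r) {c : ℝ}
    (h : ∀ y, Φ (r • y) = c * Φ y) (i : Fin (n + 1)) (y : Euc n) :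
    partialDeriv i Φ (r • y) = (r : ℂ)⁻¹ * c * partialDeriv i Φ y := by
  have h1 := fderiv_comp_smul (f := Φ) (x := y) r
  have h2 : (fun x => Φ (r • x)) = c • Φ := funext fun y => by simp [h]
  rw [h2, fderiv_const_smul_field] at h1
  have h3 := congrArg (fun L => L (EuclideanSpace.single i (1 : ℝ))) h1
  simp only [Pi.smul_apply, smul_apply, Complex.real_smul] at h3
  have hr' : (r : ℂ) ≠ 0 := by exact_mod_cast hr.ne'
  unfold partialDeriv
  rw [mul_assoc, h3, inv_mul_cancel_left₀ hr']

theorem partialDeriv_radialExt_smul (φ : Sph n → ℂ) {r : ℝ} (hr : 0 < r) (i : Fin (n + 1))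
    (y : Euc n) :
    partialDeriv i (radialExt φ) (r • y) = (r : ℂ)⁻¹ * partialDeriv i (radialExt φ) y := by
  simpa using partialDeriv_smul_of_homogeneous (c := 1) hr
    (fun y => by rw [radialExt_smul φ hr, Complex.ofReal_one, one_mul]) i y

theorem IsC2.laplacian_radialExt_smul {φ : Sph n → ℂ} (hφ : IsC2 φ) {r : ℝ} (hr : 0 < r)
    (x : Sph n) :
    Laplacian.laplacian (radialExt φ) (r • (x : Euc n)) = ((r ^ 2)⁻¹ : ℝ) * laplaceBeltrami φ x := by
  have hx : (x : Euc n) ≠ 0 := ne_zero_of_mem_unit_sphere x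
  unfold laplaceBeltrami
  rw [laplacian_eq_sum_partialDeriv (hφ.contDiffAt_radialExt (smul_ne_zero hr.ne' hx)),
    laplacian_eq_sum_partialDeriv (hφ.contDiffAt_radialExt hx), Finset.mul_sum]
  refine Finset.sum_congr rfl fun i _ => ?_
  rw [partialDeriv_smul_of_homogeneous (c := r⁻¹) hr
    (fun y => by rw [partialDeriv_radialExt_smul φ hr i, Complex.ofReal_inv])]
  push_cast
  ring

theorem IsC2.contDiffAt_partialDeriv {φ : Sph n → ℂ} (hφ : IsC2 φ) {y : Euc n} (hy : y ≠ 0)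
    (i : Fin (n + 1)) : ContDiffAt ℝ 1 (partialDeriv i (radialExt φ)) y :=
  ((hφ.contDiffAt_radialExt hy).fderiv_right (m := 1) (by norm_num)).clm_apply contDiffAt_const

theorem IsC2.continuousAt_laplacian {φ : Sph n → ℂ} (hφ : IsC2 φ) {y : Euc n} (hy : y ≠ 0) :
    ContinuousAt (Laplacian.laplacian (radialExt φ)) y := by
  have h : ContinuousAt (fun z => ∑ i, partialDeriv i (partialDeriv i (radialExt φ)) z) y := by
    refine tendsto_finsetSum _ fun i _ => ?_
    exact (((hφ.contDiffAt_partialDeriv hy i).fderiv_right (m := 0) (by norm_num)).clm_apply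
      contDiffAt_const).continuousAt
  refine h.congr ?_
  filter_upwards [isOpen_compl_singleton.mem_nhds hy] with z hz
  exact (laplacian_eq_sum_partialDeriv (hφ.contDiffAt_radialExt hz)).symm

theorem IsC2.continuous_laplaceBeltrami {φ : Sph n → ℂ} (hφ : IsC2 φ) :
    Continuous (laplaceBeltrami φ) := by
  refine continuous_iff_continuousAt.2 fun x => ?_
  exact (hφ.continuousAt_laplacian (ne_zero_of_mem_unit_sphere x)).comp
    continuous_subtype_val.continuousAt

theorem IsC2.continuous {φ : Sph n → ℂ} (hφ : IsC2 φ) : Continuous φ := ContMDiff.continuous hφ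

/-- Euler's relation for functions that are constant on rays. -/
theorem IsC2.sum_mul_partialDeriv {φ : Sph n → ℂ} (hφ : IsC2 φ) {y : Euc n} (hy : y ≠ 0) :
    ∑ i, (y i : ℂ) * partialDeriv i (radialExt φ) y = 0 := by
  have hd : HasFDerivAt (radialExt φ) (fderiv ℝ (radialExt φ) y) y :=
    ((hφ.contDiffAt_radialExt hy).differentiableAt (by norm_num)).hasFDerivAt
  have h1 : HasDerivAt (fun r : ℝ => radialExt φ (r • y)) (fderiv ℝ (radialExt φ) y y) 1 := by
    have hs : HasDerivAt (fun r : ℝ => r • y) y 1 := by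
      simpa using (hasDerivAt_id (1 : ℝ)).smul_const y
    exact HasFDerivAt.comp_hasDerivAt (1 : ℝ) (by simpa using hd) hs
  have h2 : HasDerivAt (fun r : ℝ => radialExt φ (r • y)) 0 1 := by
    refine (hasDerivAt_const (1 : ℝ) (radialExt φ y)).congr_of_eventuallyEq ?_
    filter_upwards [lt_mem_nhds (zero_lt_one (α := ℝ))] with r hr
    exact radialExt_smul φ hr y
  rw [← h1.unique h2]
  unfold partialDeriv
  generalize fderiv ℝ (radialExt φ) y = L
  conv_rhs => rw [← (EuclideanSpace.basisFun (Fin (n + 1)) ℝ).sum_repr y]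
  simp [map_sum]

end RadialExtension

/-! ### Integration in polar coordinates -/

section Polar

variable {n : ℕ}

/-- Moves integrals over the sphere to `ℝ^{n+1}`, where integration by parts and reflections apply.
The factor `r ^ n` is the polar Jacobian. -/
theorem integral_polar {H : Euc n → ℂ} {h : Sph n → ℂ} {k : ℝ → ℂ}
    (hH : ∀ r : ℝ, 0 < r → ∀ x : Sph n, H (r • (x : Euc n)) = h x * k r) :
    ∫ y, H y = (∫ x, h x ∂surf n) * ∫ r in Set.Ioi (0 : ℝ), (r : ℂ) ^ n * k r := by
  have hmp := (volume : Measure (Euc n)).measurePreserving_homeomorphUnitSphereProd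
  have h1 : ∫ y, H y = ∫ y : ({(0)}ᶜ : Set (Euc n)), H y ∂(Measure.comap Subtype.val volume) := by
    rw [integral_subtype_comap (measurableSet_singleton _).compl H,
      restrict_compl_singleton]
  have h2 := hmp.integral_comp (Homeomorph.measurableEmbedding _)
    (fun p : Sph n × Set.Ioi (0 : ℝ) => h p.1 * k p.2)
  have h3 (y : ({(0)}ᶜ : Set (Euc n))) : h (homeomorphUnitSphereProd (Euc n) y).1 *
      k (homeomorphUnitSphereProd (Euc n) y).2 = H y := by
    rw [← hH _ (homeomorphUnitSphereProd (Euc n) y).2.2]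
    congr 1
    have hy : ‖(y : Euc n)‖ ≠ 0 := norm_ne_zero_iff.2 y.2
    simp [smul_smul, hy]
  simp only [h3] at h2
  rw [h1, h2, integral_prod_mul h (fun r : Set.Ioi (0 : ℝ) => k r), surf]
  congr 1
  rw [Measure.volumeIoiPow]
  simp only [ENNReal.ofReal]
  rw [integral_withDensity_eq_integral_smul
    ((measurable_subtype_coe.pow_const _).real_toNNReal),
    integral_subtype_comap measurableSet_Ioi fun a : ℝ =>
      Real.toNNReal (a ^ (Module.finrank ℝ (Euc n) - 1)) • k a]
  refine setIntegral_congr_fun measurableSet_Ioi fun x hx => ?_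
  simp only [finrank_euclideanSpace, Fintype.card_fin, Nat.add_sub_cancel, NNReal.smul_def]
  rw [Real.coe_toNNReal _ (pow_nonneg (le_of_lt hx) _), Complex.real_smul]
  push_cast
  rfl

end Polar

/-! ### Green's formula on the sphere -/

section Green

/-- A smooth bump function on `(1, 3)`. -/
def bump : ContDiffBump (2 : ℝ) := ⟨1 / 2, 1, by norm_num, by norm_num⟩

theorem bump_eq_zero {s : ℝ} (hs : s ≤ 1 ∨ 3 ≤ s) : bump s = 0 := by
  refine bump.zero_of_le_dist ?_
  rw [Real.dist_eq]
  change 1 ≤ |s - 2|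
  rcases hs with hs | hs
  · rw [abs_of_nonpos] <;> linarith
  · rw [abs_of_nonneg] <;> linarith

theorem bump_pos {s : ℝ} (h1 : 1 < s) (h3 : s < 3) : 0 < bump s := by
  refine bump.pos_of_mem_ball ?_
  rw [Metric.mem_ball, Real.dist_eq, abs_lt]
  change -1 < s - 2 ∧ s - 2 < 1
  constructor <;> linarith

/-- The radial profile of the cutoff function. -/
def cutoffProfile (s : ℝ) : ℝ := s * bump s

theorem contDiff_cutoffProfile : ContDiff ℝ 1 cutoffProfile :=
  contDiff_id.mul bump.contDiff

variable {n : ℕ}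

/-- A smooth radial cutoff function on `ℝ^{n+1}` that vanishes near the origin. -/
def cutoff (y : Euc n) : ℝ := cutoffProfile (‖y‖ ^ 2)

theorem contDiff_cutoff : ContDiff ℝ 1 (cutoff (n := n)) :=
  contDiff_cutoffProfile.comp (contDiff_norm_sq ℝ)

theorem cutoff_nonneg (y : Euc n) : 0 ≤ cutoff y := mul_nonneg (by positivity) bump.nonneg

theorem cutoff_eventuallyEq_zero : ∀ᶠ y : Euc n in 𝓝 0, cutoff y = 0 := by
  filter_upwards [Metric.ball_mem_nhds (0 : Euc n) zero_lt_one] with y hy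
  rw [mem_ball_zero_iff] at hy
  rw [cutoff, cutoffProfile, bump_eq_zero (Or.inl (by nlinarith [norm_nonneg y])), mul_zero]

theorem hasCompactSupport_cutoff : HasCompactSupport (cutoff (n := n)) := by
  refine HasCompactSupport.intro (isCompact_closedBall (0 : Euc n) 2) fun y hy => ?_
  rw [mem_closedBall_zero_iff, not_le] at hy
  rw [cutoff, cutoffProfile, bump_eq_zero (Or.inr (by nlinarith)), mul_zero]

theorem fderiv_cutoff_apply (y : Euc n) (i : Fin (n + 1)) :
    fderiv ℝ cutoff y (EuclideanSpace.single i (1 : ℝ)) =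
      deriv cutoffProfile (‖y‖ ^ 2) * (2 * y i) := by
  have h1 : HasDerivAt cutoffProfile (deriv cutoffProfile (‖y‖ ^ 2)) (‖y‖ ^ 2) :=
    (contDiff_cutoffProfile.differentiable (by norm_num) _).hasDerivAt
  have h2 := h1.comp_hasFDerivAt y (hasStrictFDerivAt_norm_sq y).hasFDerivAt
  have h3 : HasFDerivAt cutoff _ y := h2
  rw [h3.fderiv]
  simp [PiLp.inner_apply]

theorem integral_fderiv_eq_zero {G : Euc n → ℂ} (hG : ContDiff ℝ 1 G) (hc : HasCompactSupport G)
    (v : Euc n) : ∫ y, fderiv ℝ G y v = 0 := by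
  have hcont : Continuous fun y => fderiv ℝ G y v :=
    (hG.continuous_fderiv (by norm_num)).clm_apply continuous_const
  have hint : Integrable fun y => fderiv ℝ G y v :=
    hcont.integrable_of_hasCompactSupport (hc.fderiv_apply (𝕜 := ℝ) v)
  have h := integral_mul_fderiv_eq_neg_fderiv_mul_of_integrable (𝕜 := ℂ) (μ := volume)
    (f := fun _ : Euc n => (1 : ℂ)) (g := G) (v := v) (by simp) (by simpa using hint)
    (by simpa using hG.continuous.integrable_of_hasCompactSupport hc)
    (fun x _ => by fun_prop) (fun x _ => hG.differentiable (by norm_num) x)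
  simpa using h

/-- A product with the cutoff function of a function that is smooth off the origin is smooth. -/
theorem contDiff_mul_cutoff {m : WithTop ℕ∞} (hm : m ≤ 1) {H : Euc n → ℂ}
    (hH : ∀ y ≠ 0, ContDiffAt ℝ m H y) : ContDiff ℝ m fun y => H y * cutoff y := by
  rw [contDiff_iff_contDiffAt]
  intro y
  by_cases hy : y = 0
  · subst hy
    refine (contDiffAt_const (c := (0 : ℂ))).congr_of_eventuallyEq ?_
    filter_upwards [cutoff_eventuallyEq_zero] with y hy
    simp [hy]
  · exact (hH y hy).mul (Complex.ofRealCLM.contDiff.contDiffAt.comp y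
      ((contDiff_cutoff.of_le hm).contDiffAt))

theorem hasCompactSupport_mul_cutoff (H : Euc n → ℂ) :
    HasCompactSupport fun y => H y * cutoff y := by
  have h : HasCompactSupport fun y : Euc n => (cutoff y : ℂ) :=
    hasCompactSupport_cutoff.comp_left (g := fun r : ℝ => (r : ℂ)) (by simp)
  exact h.mul_left

theorem integrable_mul_cutoff {H : Euc n → ℂ} (hH : ∀ y ≠ 0, ContinuousAt H y) :
    Integrable fun y => H y * cutoff y := by
  refine Continuous.integrable_of_hasCompactSupport ?_ (hasCompactSupport_mul_cutoff H)
  rw [continuous_iff_continuousAt]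
  intro y
  by_cases hy : y = 0
  · subst hy
    refine (continuousAt_const (y := (0 : ℂ))).congr ?_
    filter_upwards [cutoff_eventuallyEq_zero] with y hy
    simp [hy]
  · exact (hH y hy).mul (Complex.continuous_ofReal.comp contDiff_cutoff.continuous).continuousAt

/-- The pointwise inner product of the gradients of two functions on the sphere, extended to
`ℝ^{n+1}`. -/
def gradInner (φ ψ : Sph n → ℂ) (y : Euc n) : ℂ :=
  ∑ i, partialDeriv i (radialExt φ) y * conj (partialDeriv i (radialExt ψ) y)

/-- Each `G i` is `C¹` with compact support, so its `i`-th derivative integrates to zero. The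
product rule produces the Laplacian term, the gradient term, and a term from the cutoff that
disappears because the gradient of a radial function is parallel to `y`. -/
theorem integral_laplacian_mul_cutoff {φ ψ : Sph n → ℂ} (hφ : IsC2 φ) (hψ : IsC2 ψ) :
    ∫ y, Laplacian.laplacian (radialExt φ) y * conj (radialExt ψ y) * cutoff y =
      -∫ y, gradInner φ ψ y * cutoff y := by
  set G : Fin (n + 1) → Euc n → ℂ := fun i y =>
    partialDeriv i (radialExt φ) y * conj (radialExt ψ y) * cutoff y with hGdef
  have hconj (y : Euc n) (hy : y ≠ 0) : ContDiffAt ℝ 2 (fun y => conj (radialExt ψ y)) y :=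
    Complex.conjCLE.contDiff.contDiffAt.comp y (hψ.contDiffAt_radialExt hy)
  have hG (i) : ContDiff ℝ 1 (G i) := contDiff_mul_cutoff le_rfl fun y hy =>
    (hφ.contDiffAt_partialDeriv hy i).mul ((hconj y hy).of_le (by norm_num))
  have hGc (i) : HasCompactSupport (G i) := hasCompactSupport_mul_cutoff _
  have h0 (i) := integral_fderiv_eq_zero (hG i) (hGc i) (EuclideanSpace.single i (1 : ℝ))
  have hGi (i) : Integrable fun y => fderiv ℝ (G i) y (EuclideanSpace.single i (1 : ℝ)) :=
    (((hG i).continuous_fderiv (by norm_num)).clm_apply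
      continuous_const).integrable_of_hasCompactSupport ((hGc i).fderiv_apply (𝕜 := ℝ) _)
  have hS : Integrable fun y => gradInner φ ψ y * cutoff y := by
    refine integrable_mul_cutoff fun y hy => ?_
    refine tendsto_finsetSum _ fun i _ => ?_
    exact ((hφ.contDiffAt_partialDeriv hy i).continuousAt).mul
      (Complex.continuous_conj.continuousAt.comp (hψ.contDiffAt_partialDeriv hy i).continuousAt)
  have hae : (fun y => Laplacian.laplacian (radialExt φ) y * conj (radialExt ψ y) * cutoff y)
      =ᵐ[volume] fun y => (∑ i, fderiv ℝ (G i) y (EuclideanSpace.single i (1 : ℝ)))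
        - gradInner φ ψ y * cutoff y := by
    have hne : ∀ᵐ y : Euc n, y ≠ 0 := by
      simp [ae_iff]
    filter_upwards [hne] with y hy
    have hd (i) : fderiv ℝ (G i) y (EuclideanSpace.single i (1 : ℝ)) =
        partialDeriv i (partialDeriv i (radialExt φ)) y * conj (radialExt ψ y) * cutoff y +
        partialDeriv i (radialExt φ) y * conj (partialDeriv i (radialExt ψ) y) * cutoff y +
        (y i * partialDeriv i (radialExt φ) y) *
          (conj (radialExt ψ y) * (2 * deriv cutoffProfile (‖y‖ ^ 2) : ℝ)) := by
      have d1 := ((hφ.contDiffAt_partialDeriv hy i).differentiableAt (by norm_num)).hasFDerivAt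
      have d2 := Complex.conjCLE.hasFDerivAt.comp y
        ((hψ.contDiffAt_radialExt hy).differentiableAt (by norm_num)).hasFDerivAt
      have d3 := Complex.ofRealCLM.hasFDerivAt.comp y
        (contDiff_cutoff.differentiable (by norm_num) y).hasFDerivAt
      have d := (d1.mul d2).mul d3
      have d' : HasFDerivAt (G i) _ y := d
      rw [d'.fderiv]
      simp [fderiv_cutoff_apply, partialDeriv]
      ring
    -- Summed over `i`, the last term of `hd` contains the Euler sum of `radialExt φ`, which is
    -- zero.
    simp only [hd]
    rw [Finset.sum_add_distrib, Finset.sum_add_distrib, ← Finset.sum_mul, ← Finset.sum_mul,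
      ← Finset.sum_mul, ← Finset.sum_mul, hφ.sum_mul_partialDeriv hy,
      laplacian_eq_sum_partialDeriv (hφ.contDiffAt_radialExt hy), gradInner]
    ring
  rw [integral_congr_ae hae, integral_sub (integrable_finsetSum _ fun i _ => hGi i) hS,
    integral_finsetSum _ fun i _ => hGi i]
  simp [h0]

/-- The positive constant by which the radial integration multiplies. -/
def radialMass (n : ℕ) : ℝ := ∫ r in Set.Ioi (0 : ℝ), r ^ n * bump (r ^ 2)

theorem radialMass_pos (n : ℕ) : 0 < radialMass n := by
  have hcont : Continuous fun r : ℝ => r ^ n * bump (r ^ 2) :=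
    (continuous_pow n).mul (bump.continuous.comp (continuous_pow 2))
  have hc : HasCompactSupport fun r : ℝ => r ^ n * bump (r ^ 2) := by
    refine HasCompactSupport.intro (isCompact_Icc (a := (-2 : ℝ)) (b := 2)) fun r hr => ?_
    rw [bump_eq_zero (Or.inr ?_), mul_zero]
    rw [Set.mem_Icc, not_and_or, not_le, not_le] at hr
    rcases hr with hr | hr <;> nlinarith
  rw [radialMass, setIntegral_pos_iff_support_of_nonneg_ae]
  -- The squares of these radii lie in `(1, 3)`, where the bump is positive.
  · have hsub : Set.Ioo (1.2 : ℝ) 1.5 ⊆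
        (Function.support fun r : ℝ => r ^ n * bump (r ^ 2)) ∩ Set.Ioi 0 := by
      intro r hr
      have hr0 : (0 : ℝ) < r := by linarith [hr.1]
      refine ⟨?_, hr0⟩
      have := bump_pos (s := r ^ 2) (by nlinarith [hr.1]) (by nlinarith [hr.1, hr.2])
      exact (mul_pos (pow_pos hr0 n) this).ne'
    refine lt_of_lt_of_le ?_ (measure_mono hsub)
    rw [Real.volume_Ioo]
    norm_num
  · filter_upwards [ae_restrict_mem measurableSet_Ioi] with r hr
    exact mul_nonneg (pow_nonneg (le_of_lt hr) n) bump.nonneg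
  · exact (hcont.integrable_of_hasCompactSupport hc).integrableOn

/-- The sesquilinear form `- ∫ Δ*φ · conj ψ dσ`. -/
def lbInner (φ ψ : Sph n → ℂ) : ℂ := -∫ x, laplaceBeltrami φ x * conj (ψ x) ∂(surf n)

theorem lbForm_eq_lbInner (φ : Sph n → ℂ) : lbForm φ = lbInner φ φ := rfl

/-- Green's formula on the sphere, integrated over the radii. -/
theorem lbInner_mul_radialMass {φ ψ : Sph n → ℂ} (hφ : IsC2 φ) (hψ : IsC2 ψ) :
    lbInner φ ψ * radialMass n = ∫ y, gradInner φ ψ y * cutoff y := by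
  have hp := integral_polar (n := n)
    (H := fun y => Laplacian.laplacian (radialExt φ) y * conj (radialExt ψ y) * cutoff y)
    (h := fun x => laplaceBeltrami φ x * conj (ψ x)) (k := fun r => ((bump (r ^ 2) : ℝ) : ℂ)) (by
      intro r hr x
      have hr' : (r : ℂ) ≠ 0 := by exact_mod_cast hr.ne'
      -- The factor `s` in `cutoffProfile` is the `r ^ 2` that cancels the homogeneity `-2` of the
      -- Laplacian, leaving `bump (r ^ 2)`.
      rw [hφ.laplacian_radialExt_smul hr, radialExt_smul ψ hr, radialExt_coe, cutoff, norm_smul,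
        norm_eq_of_mem_sphere, mul_one, Real.norm_of_nonneg hr.le, cutoffProfile]
      push_cast
      field_simp)
  rw [integral_laplacian_mul_cutoff hφ hψ] at hp
  have hm : ∫ r in Set.Ioi (0 : ℝ), (r : ℂ) ^ n * ((bump (r ^ 2) : ℝ) : ℂ) = radialMass n := by
    rw [radialMass, ← integral_complex_ofReal]
    push_cast
    rfl
  rw [hm] at hp
  rw [lbInner, neg_mul, ← hp, neg_neg]

/-- The gradient integral is visibly Hermitian, and the positive factor `radialMass n` cancels. -/
theorem lbInner_conj_symm {φ ψ : Sph n → ℂ} (hφ : IsC2 φ) (hψ : IsC2 ψ) :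
    conj (lbInner φ ψ) = lbInner ψ φ := by
  have hm : (radialMass n : ℂ) ≠ 0 := by exact_mod_cast (radialMass_pos n).ne'
  apply mul_right_cancel₀ hm
  rw [lbInner_mul_radialMass hψ hφ]
  have := congrArg conj (lbInner_mul_radialMass hφ hψ)
  rw [map_mul, Complex.conj_ofReal] at this
  rw [this, ← integral_conj]
  congr 1
  ext y
  simp [gradInner, mul_comm]

theorem lbInner_self_nonneg {φ : Sph n → ℂ} (hφ : IsC2 φ) : 0 ≤ (lbInner φ φ).re := by
  have h := lbInner_mul_radialMass hφ hφ
  have hg (y : Euc n) : gradInner φ φ y * cutoff y =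
      ((∑ i, ‖partialDeriv i (radialExt φ) y‖ ^ 2) * cutoff y : ℝ) := by
    simp [gradInner, Complex.mul_conj, Complex.normSq_eq_norm_sq]
  simp only [hg] at h
  rw [integral_complex_ofReal] at h
  have h' := congrArg Complex.re h
  rw [Complex.re_mul_ofReal, Complex.ofReal_re] at h'
  have hn : 0 ≤ ∫ y : Euc n, (∑ i, ‖partialDeriv i (radialExt φ) y‖ ^ 2) * cutoff y :=
    integral_nonneg fun y => mul_nonneg (by positivity) (cutoff_nonneg y)
  rw [← h'] at hn
  exact nonneg_of_mul_nonneg_left hn (radialMass_pos n)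

end Green

/-! ### Closability of the Dirichlet form -/

section Closability

/-- The difference `u = φ - g` is Cauchy and weakly null, hence null in norm, without completeness:
compare `u k` with one fixed `u m` far out. A seminorm suffices. -/
theorem norm_sq_tendsto_of_weak {V : Type*} [SeminormedAddCommGroup V] [InnerProductSpace ℂ V]
    {φ g : ℕ → V} (hφ : Tendsto (fun p : ℕ × ℕ => ‖φ p.1 - φ p.2‖ ^ 2) atTop (𝓝 0))
    (hg : Tendsto (fun p : ℕ × ℕ => ‖g p.1 - g p.2‖ ^ 2) atTop (𝓝 0))
    (hw : ∀ v, Tendsto (fun k => inner ℂ v (φ k - g k)) atTop (𝓝 0)) {L : ℝ}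
    (hL : Tendsto (fun k => ‖g k‖ ^ 2) atTop (𝓝 L)) :
    Tendsto (fun k => ‖φ k‖ ^ 2) atTop (𝓝 L) := by
  have hsq {X : Type} {F : Filter X} {u : X → ℝ} (hu0 : ∀ x, 0 ≤ u x)
      (hu : Tendsto (fun x => u x ^ 2) F (𝓝 0)) : Tendsto u F (𝓝 0) := by
    have := hu.sqrt
    simpa [Real.sqrt_sq (hu0 _)] using this
  set u : ℕ → V := fun k => φ k - g k with hu
  have hc : Tendsto (fun p : ℕ × ℕ => ‖u p.1 - u p.2‖) atTop (𝓝 0) := by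
    have h1 := (hsq (fun _ => norm_nonneg _) hφ).add (hsq (fun _ => norm_nonneg _) hg)
    rw [add_zero] at h1
    refine squeeze_zero (fun _ => norm_nonneg _) (fun p => ?_) h1
    have : u p.1 - u p.2 = (φ p.1 - φ p.2) - (g p.1 - g p.2) := by simp only [hu]; abel
    rw [this]
    exact norm_sub_le _ _
  have hu0 : Tendsto (fun k => ‖u k‖) atTop (𝓝 0) := by
    rw [Metric.tendsto_atTop]
    intro ε hε
    obtain ⟨⟨N1, N2⟩, hN⟩ := (Metric.tendsto_atTop.1 hc) (ε / 2) (by positivity)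
    set m := max N1 N2 with hm
    have hN' (k : ℕ) (hk : m ≤ k) : ‖u k - u m‖ < ε / 2 := by
      have := hN (k, m) ⟨le_trans (le_max_left _ _) hk, le_max_right _ _⟩
      simpa using this
    have hw1 : Tendsto (fun k => ‖inner ℂ (u m) (u k)‖) atTop (𝓝 0) := by
      simpa using (hw (u m)).norm
    obtain ⟨N3, hN3⟩ := (Metric.tendsto_atTop.1 hw1) (ε ^ 2 / 2) (by positivity)
    refine ⟨max m N3, fun k hk => ?_⟩
    have a1 := hN' k (le_trans (le_max_left _ _) hk)
    have a2 : ‖inner ℂ (u m) (u k)‖ < ε ^ 2 / 2 := by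
      simpa using hN3 k (le_trans (le_max_right _ _) hk)
    rw [dist_zero_right, norm_norm]
    -- Split the left factor of `⟪u k, u k⟫` as `(u k - u m) + u m`: the first part is small by the
    -- Cauchy property, the second by weak convergence tested on the fixed vector `u m`.
    have a3 : ‖u k‖ ^ 2 ≤ ‖u k - u m‖ * ‖u k‖ + ‖inner ℂ (u m) (u k)‖ := by
      have e1 : ((‖u k‖ ^ 2 : ℝ) : ℂ) = inner ℂ (u k - u m) (u k) + inner ℂ (u m) (u k) := by
        rw [← inner_add_left, sub_add_cancel, inner_self_eq_norm_sq_to_K]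
        simp
      have e2 : ‖u k‖ ^ 2 = ‖((‖u k‖ ^ 2 : ℝ) : ℂ)‖ := by
        rw [Complex.norm_real, Real.norm_of_nonneg (by positivity)]
      rw [e2, e1]
      exact (norm_add_le _ _).trans (add_le_add_left (norm_inner_le_norm _ _) _)
    -- If `‖u k‖ ≥ ε`, both terms on the right of `a3` are below `‖u k‖ ^ 2 / 2`.
    by_contra! hcon
    nlinarith [norm_nonneg (u k), norm_nonneg (u k - u m)]
  have hgn : Tendsto (fun k => ‖g k‖) atTop (𝓝 √L) := by
    have := hL.sqrt
    simpa [Real.sqrt_sq (norm_nonneg _)] using this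
  have hL0 : 0 ≤ L := ge_of_tendsto' hL fun _ => by positivity
  have hφn : Tendsto (fun k => ‖φ k‖) atTop (𝓝 √L) := by
    have hd : Tendsto (fun k => ‖φ k‖ - ‖g k‖) atTop (𝓝 0) :=
      squeeze_zero_norm (fun k => abs_norm_sub_norm_le _ _) hu0
    simpa using hd.add hgn
  simpa [Real.sq_sqrt hL0] using hφn.pow 2

/-- The Dirichlet form is only semidefinite, as constants have zero energy, so the seminormed
structure is built from a pre-inner-product core inside the proof. -/
theorem core_tendsto_of_weak {V : Type*} [AddCommGroup V] [Module ℂ V]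
    (c : PreInnerProductSpace.Core ℂ V) {φ g : ℕ → V}
    (hφ : Tendsto (fun p : ℕ × ℕ => (c.inner (φ p.1 - φ p.2) (φ p.1 - φ p.2)).re) atTop (𝓝 0))
    (hg : Tendsto (fun p : ℕ × ℕ => (c.inner (g p.1 - g p.2) (g p.1 - g p.2)).re) atTop (𝓝 0))
    (hw : ∀ v, Tendsto (fun k => c.inner v (φ k - g k)) atTop (𝓝 0)) {L : ℝ}
    (hL : Tendsto (fun k => (c.inner (g k) (g k)).re) atTop (𝓝 L)) :
    Tendsto (fun k => (c.inner (φ k) (φ k)).re) atTop (𝓝 L) := by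
  let _ : SeminormedAddCommGroup V := InnerProductSpace.Core.toSeminormedAddCommGroup (c := c)
  let _ : InnerProductSpace ℂ V := InnerProductSpace.ofCore c
  have h (x : V) : (c.inner x x).re = ‖x‖ ^ 2 := (norm_sq_eq_re_inner (𝕜 := ℂ) x).symm
  simp only [h] at hφ hg hL ⊢
  exact norm_sq_tendsto_of_weak hφ hg hw hL

variable {n : ℕ}

instance : IsFiniteMeasure (surf n) := by unfold surf; infer_instance

/-- The space of functions of class `C²` on the sphere. -/
def c2Submodule (n : ℕ) : Submodule ℂ (Sph n → ℂ) where
  carrier := {φ | IsC2 φ}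
  zero_mem' := contMDiff_const
  add_mem' := fun h1 h2 => ContMDiff.add h1 h2
  smul_mem' := fun c φ h => by
    have h1 : ContMDiff 𝓘(ℝ, ℂ) 𝓘(ℝ, ℂ) 2 fun z : ℂ => c * z :=
      (contDiff_const.mul contDiff_id).contMDiff
    exact h1.comp h

theorem IsC2.sub {φ ψ : Sph n → ℂ} (hφ : IsC2 φ) (hψ : IsC2 ψ) : IsC2 (φ - ψ) :=
  (c2Submodule n).sub_mem hφ hψ

theorem integrable_laplaceBeltrami_mul {φ ψ : Sph n → ℂ} (hφ : IsC2 φ) (hψ : Continuous ψ) :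
    Integrable (fun x => laplaceBeltrami φ x * conj (ψ x)) (surf n) :=
  (hφ.continuous_laplaceBeltrami.mul
    (Complex.continuous_conj.comp hψ)).integrable_of_hasCompactSupport
      (HasCompactSupport.of_compactSpace _)

theorem lbInner_add_right {φ ψ₁ ψ₂ : Sph n → ℂ} (hφ : IsC2 φ) (h₁ : IsC2 ψ₁) (h₂ : IsC2 ψ₂) :
    lbInner φ (ψ₁ + ψ₂) = lbInner φ ψ₁ + lbInner φ ψ₂ := by
  simp only [lbInner, Pi.add_apply, map_add, mul_add]
  rw [integral_add (integrable_laplaceBeltrami_mul hφ h₁.continuous)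
    (integrable_laplaceBeltrami_mul hφ h₂.continuous), neg_add]

theorem lbInner_smul_right (φ ψ : Sph n → ℂ) (r : ℂ) :
    lbInner φ (r • ψ) = conj r * lbInner φ ψ := by
  simp only [lbInner, Pi.smul_apply, smul_eq_mul, map_mul]
  rw [mul_neg, ← integral_const_mul]
  congr 2
  ext x
  ring

/-- The Dirichlet form as a semi-inner product on the functions of class `C²`. -/
abbrev dirichletCore (n : ℕ) : PreInnerProductSpace.Core ℂ (c2Submodule n) where
  inner φ ψ := lbInner ψ.1 φ.1
  conj_inner_symm φ ψ := lbInner_conj_symm φ.2 ψ.2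
  re_inner_nonneg φ := lbInner_self_nonneg φ.2
  add_left φ ψ χ := lbInner_add_right χ.2 φ.2 ψ.2
  smul_left φ ψ r := lbInner_smul_right ψ.1 φ.1 r

theorem IsC2.lbForm_eq_re {φ : Sph n → ℂ} (hφ : IsC2 φ) : lbForm φ = ((lbForm φ).re : ℂ) :=
  (Complex.conj_eq_iff_re.1 (lbInner_conj_symm hφ hφ)).symm

/-- `Δ*φ` is continuous, hence bounded, on the compact sphere, and `L²` convergence implies `L¹`
convergence for a finite measure. This is what turns `L²`-null sequences into weakly null ones for
the form. -/
theorem tendsto_lbInner_zero {φ : Sph n → ℂ} (hφ : IsC2 φ) {u : ℕ → Sph n → ℂ}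
    (huc : ∀ k, Continuous (u k))
    (hu : Tendsto (fun k => eLpNorm (u k) 2 (surf n)) atTop (𝓝 0)) :
    Tendsto (fun k => lbInner φ (u k)) atTop (𝓝 0) := by
  have hsub : Tendsto (fun k => eLpNorm (u k) 1 (surf n)) atTop (𝓝 0) := by
    have h2 := ENNReal.Tendsto.mul_const (b := (surf n Set.univ) ^
      (1 / (1 : ENNReal).toReal - 1 / (2 : ENNReal).toReal)) hu
      (Or.inr (ENNReal.rpow_ne_top_of_nonneg (by norm_num) (measure_ne_top _ _)))
    rw [zero_mul] at h2
    exact tendsto_of_tendsto_of_tendsto_of_le_of_le tendsto_const_nhds h2 (fun _ => zero_le)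
      fun k => eLpNorm_le_eLpNorm_mul_rpow_measure_univ (by norm_num)
        (huc k).aestronglyMeasurable
  obtain ⟨C, hC⟩ := (isCompact_univ (X := Sph n)).exists_bound_of_continuousOn
    hφ.continuous_laplaceBeltrami.continuousOn
  have hint (k : ℕ) : Integrable (u k) (surf n) :=
    (huc k).integrable_of_hasCompactSupport (HasCompactSupport.of_compactSpace _)
  have hn (k : ℕ) : ∫ x, ‖u k x‖ ∂(surf n) = (eLpNorm (u k) 1 (surf n)).toReal := by
    rw [eLpNorm_one_eq_lintegral_enorm, integral_norm_eq_lintegral_enorm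
      (huc k).aestronglyMeasurable]
  have hreal : Tendsto (fun k => C * ∫ x, ‖u k x‖ ∂(surf n)) atTop (𝓝 0) := by
    simp only [hn]
    simpa using ((ENNReal.tendsto_toReal ENNReal.zero_ne_top).comp hsub).const_mul C
  refine squeeze_zero_norm (fun k => ?_) hreal
  rw [lbInner, norm_neg, ← integral_const_mul]
  refine norm_integral_le_of_norm_le ((hint k).norm.const_mul C) (Eventually.of_forall fun x => ?_)
  rw [norm_mul, RCLike.norm_conj]
  exact mul_le_mul_of_nonneg_right (hC x (Set.mem_univ x)) (norm_nonneg _)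

/-- The form `- ∫ Δ*φ · conj φ dσ` is closable: two form-Cauchy sequences with the same limit in
`L²` give the same value. -/
theorem tendsto_lbForm_of_tendsto {f : Sph n → ℂ} (hf : AEStronglyMeasurable f (surf n))
    {φ g : ℕ → Sph n → ℂ}
    (hφ : ∀ k, IsC2 (φ k)) (hg : ∀ k, IsC2 (g k))
    (hφf : Tendsto (fun k => eLpNorm (φ k - f) 2 (surf n)) atTop (𝓝 0))
    (hgf : Tendsto (fun k => eLpNorm (g k - f) 2 (surf n)) atTop (𝓝 0))
    (hφc : Tendsto (fun p : ℕ × ℕ => lbForm (φ p.1 - φ p.2)) atTop (𝓝 0))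
    (hgc : Tendsto (fun p : ℕ × ℕ => lbForm (g p.1 - g p.2)) atTop (𝓝 0))
    {L : ℝ} (hL : Tendsto (fun k => lbForm (g k)) atTop (𝓝 (L : ℂ))) :
    Tendsto (fun k => lbForm (φ k)) atTop (𝓝 (L : ℂ)) := by
  have hre {X : Type} {F : Filter X} {w : X → ℂ} {z : ℂ} (h : Tendsto w F (𝓝 z)) :
      Tendsto (fun x => (w x).re) F (𝓝 z.re) := (Complex.continuous_re.tendsto z).comp h
  have hu : Tendsto (fun k => eLpNorm (φ k - g k) 2 (surf n)) atTop (𝓝 0) := by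
    have h1 := hφf.add hgf
    rw [add_zero] at h1
    refine tendsto_of_tendsto_of_tendsto_of_le_of_le tendsto_const_nhds h1 (fun _ => zero_le)
      fun k => ?_
    have : φ k - g k = (φ k - f) - (g k - f) := by abel
    rw [this]
    exact eLpNorm_sub_le ((hφ k).continuous.aestronglyMeasurable.sub hf)
      ((hg k).continuous.aestronglyMeasurable.sub hf) (by norm_num)
  have key := core_tendsto_of_weak (dirichletCore n) (φ := fun k => ⟨φ k, hφ k⟩)
    (g := fun k => ⟨g k, hg k⟩) (L := L) (hre hφc) (hre hgc) (fun v => ?_) (hre hL)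
  · have := (Complex.continuous_ofReal.tendsto L).comp key
    refine this.congr fun k => ?_
    exact (hφ k).lbForm_eq_re.symm
  · have h := tendsto_lbInner_zero v.2 (fun k => ((hφ k).sub (hg k)).continuous) hu
    have h' := (Complex.continuous_conj.tendsto 0).comp h
    rw [map_zero] at h'
    exact h'.congr fun k => lbInner_conj_symm v.2 ((hφ k).sub (hg k))

end Closability

/-! ### The Laplace–Beltrami operator on zonal polynomials -/

section ZonalPolynomials

variable {n : ℕ}

/-- The zonal function on the sphere given by a real polynomial. -/
def zonalPoly (n : ℕ) (p : Polynomial ℝ) : Sph n → ℂ :=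
  fun x => ((p.eval ((x : Euc n) 0) : ℝ) : ℂ)

theorem isC2_zonalPoly (p : Polynomial ℝ) : IsC2 (zonalPoly n p) := by
  have := Fact.mk (@finrank_euclideanSpace_fin ℝ _ (n + 1))
  have hp : ContDiff ℝ 2 fun t : ℝ => p.eval t := by simpa using p.contDiff_aeval (𝕜 := ℝ) 2
  have hy : ContDiff ℝ 2 fun y : Euc n => y 0 :=
    (EuclideanSpace.proj 0 : Euc n →L[ℝ] ℝ).contDiff
  have h : ContDiff ℝ 2 fun y : Euc n => ((p.eval (y 0) : ℝ) : ℂ) :=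
    Complex.ofRealCLM.contDiff.comp (hp.comp hy)
  exact h.contMDiff.comp (contMDiff_coe_sphere (E := Euc n))

theorem partialDeriv_ofReal {f : Euc n → ℝ} {f' : Euc n →L[ℝ] ℝ} {y : Euc n}
    (h : HasFDerivAt f f' y) (i : Fin (n + 1)) :
    partialDeriv i (fun z => (f z : ℂ)) y = (f' (EuclideanSpace.single i (1 : ℝ)) : ℂ) := by
  have h2 : HasFDerivAt (fun z => (f z : ℂ)) (Complex.ofRealCLM.comp f') y :=
    Complex.ofRealCLM.hasFDerivAt.comp y h
  rw [partialDeriv, h2.fderiv]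
  rfl

theorem hasFDerivAt_norm_inv {y : Euc n} (hy : y ≠ 0) :
    HasFDerivAt (fun z : Euc n => ‖z‖⁻¹) (-(‖y‖⁻¹ ^ 3) • innerSL ℝ y) y := by
  have hn : ‖y‖ ≠ 0 := norm_ne_zero_iff.2 hy
  have h1 := (hasStrictFDerivAt_norm_sq y).hasFDerivAt.sqrt (pow_ne_zero 2 hn)
  have hs : √(‖y‖ ^ 2) ≠ 0 := by positivity
  have hi : HasDerivAt (fun t : ℝ => t⁻¹) (-(√(‖y‖ ^ 2) ^ 2)⁻¹) (√(‖y‖ ^ 2)) := hasDerivAt_inv hs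
  have h2 := hi.comp_hasFDerivAt y h1
  have h3 := h2.congr_of_eventuallyEq (f₁ := fun z : Euc n => ‖z‖⁻¹)
    (Eventually.of_forall fun z => by simp)
  refine h3.congr_fderiv ?_
  ext v
  simp only [norm_nonneg, Real.sqrt_sq, smul_apply, smul_eq_mul]
  simp
  field_simp

/-- Near a unit vector the extension is `p (z₀ / ‖z‖)`; its second partial derivatives are computed
by the chain rule, evaluated at `‖y‖ = 1` and summed. -/
theorem laplaceBeltrami_zonalPoly (p : Polynomial ℝ) :
    laplaceBeltrami (zonalPoly n p) = zonalPoly n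
      ((1 - Polynomial.X ^ 2) * p.derivative.derivative
        - (n : Polynomial ℝ) * Polynomial.X * p.derivative) := by
  ext x
  obtain ⟨y, hy1⟩ := x
  have hy1' : ‖y‖ = 1 := by simpa using hy1
  have hy : y ≠ 0 := by rintro rfl; simp at hy1'
  have hΦ : radialExt (zonalPoly n p) =ᶠ[𝓝 y]
      fun z => ((p.eval (z 0 * ‖z‖⁻¹) : ℝ) : ℂ) := by
    filter_upwards [isOpen_compl_singleton.mem_nhds hy] with z hz
    rw [radialExt_of_ne _ hz]
    simp [zonalPoly, mul_comm]
  set e : Fin (n + 1) → ℝ := fun i => (EuclideanSpace.single i (1 : ℝ) : Euc n) 0 with he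
  have hinner (z : Euc n) (i) : inner ℝ z (EuclideanSpace.single i (1 : ℝ)) = z i := by
    simp [PiLp.inner_apply]
  have hpr (i) (v : Euc n) : (EuclideanSpace.proj i : Euc n →L[ℝ] ℝ) v = v i := rfl
  have hproj (i) (z : Euc n) : HasFDerivAt (fun z : Euc n => z i)
      (EuclideanSpace.proj i : Euc n →L[ℝ] ℝ) z :=
    (EuclideanSpace.proj i : Euc n →L[ℝ] ℝ).hasFDerivAt
  have hs (z : Euc n) (hz : z ≠ 0) := (hproj 0 z).mul (hasFDerivAt_norm_inv hz)
  have hD (q : Polynomial ℝ) (z : Euc n) (hz : z ≠ 0) :=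
    (q.hasDerivAt (z 0 * ‖z‖⁻¹)).comp_hasFDerivAt z (hs z hz)
  have h1 (i) (z : Euc n) (hz : z ≠ 0) :
      partialDeriv i (fun z => ((p.eval (z 0 * ‖z‖⁻¹) : ℝ) : ℂ)) z =
      ((p.derivative.eval (z 0 * ‖z‖⁻¹) * (e i * ‖z‖⁻¹ - z 0 * z i * ‖z‖⁻¹ ^ 3) : ℝ) : ℂ) := by
    have hDz : HasFDerivAt (fun z : Euc n => p.eval (z 0 * ‖z‖⁻¹)) _ z := hD p z hz
    rw [partialDeriv_ofReal hDz]
    congr 1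
    simp only [add_apply, smul_apply, innerSL_apply_apply, hinner, smul_eq_mul,
      hpr, he]
    ring
  have h2 (i) : partialDeriv i (partialDeriv i (radialExt (zonalPoly n p))) y =
      ((p.derivative.derivative.eval (y 0) * (e i - y 0 * y i) ^ 2 +
        p.derivative.eval (y 0) * (3 * y 0 * y i ^ 2 - 2 * (e i * y i) - y 0) : ℝ) : ℂ) := by
    have hev : partialDeriv i (radialExt (zonalPoly n p)) =ᶠ[𝓝 y] fun z =>
        ((p.derivative.eval (z 0 * ‖z‖⁻¹) * (e i * ‖z‖⁻¹ - z 0 * z i * ‖z‖⁻¹ ^ 3) : ℝ) : ℂ) := by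
      filter_upwards [isOpen_compl_singleton.mem_nhds hy, hΦ.fderiv (𝕜 := ℝ)] with z hz hz'
      rw [← h1 i z hz, partialDeriv, hz', partialDeriv]
    rw [partialDeriv, hev.fderiv_eq]
    have hq := hasFDerivAt_norm_inv hy
    have hd := (hD p.derivative y hy).mul
      ((hq.const_mul (e i)).sub (((hproj 0 y).mul (hproj i y)).mul (hq.pow 3)))
    have hd' : HasFDerivAt (fun z : Euc n => p.derivative.eval (z 0 * ‖z‖⁻¹) *
      (e i * ‖z‖⁻¹ - z 0 * z i * ‖z‖⁻¹ ^ 3)) _ y := hd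
    refine (partialDeriv_ofReal hd' i).trans ?_
    congr 1
    simp only [add_apply, sub_apply, smul_apply, innerSL_apply_apply, hinner, smul_eq_mul,
      hpr, Function.comp_apply, hy1', Pi.mul_apply]
    have hii : (EuclideanSpace.single i (1 : ℝ) : Euc n) i = 1 := by simp
    rw [hii]
    change _ * _ + _ * _ = _
    have hei : (EuclideanSpace.single i (1 : ℝ) : Euc n) 0 = e i := rfl
    rw [hei]
    simp [hy1']
    ring
  have hC2 := (isC2_zonalPoly (n := n) p).contDiffAt_radialExt hy
  rw [laplaceBeltrami, laplacian_eq_sum_partialDeriv hC2]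
  simp only [h2]
  rw [← Complex.ofReal_sum, zonalPoly]
  congr 1
  have hsum : ∑ i, y i ^ 2 = 1 := by
    have := EuclideanSpace.norm_sq_eq y
    rw [hy1'] at this
    simpa using this.symm
  have he1 : ∑ i, e i * y i = y 0 := by
    simp [he]
  have he2 : ∑ i, e i ^ 2 = 1 := by
    simp [he]
  -- Expanded so that the sum over `i` uses only `∑ e i ^ 2 = 1`, `∑ e i * y i = y 0` and `∑ y i ^ 2
  -- = 1`; the last term is constant and is counted `n + 1` times.
  have hexp (i) : p.derivative.derivative.eval (y 0) * (e i - y 0 * y i) ^ 2 +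
        p.derivative.eval (y 0) * (3 * y 0 * y i ^ 2 - 2 * (e i * y i) - y 0) =
      p.derivative.derivative.eval (y 0) * e i ^ 2
      - (2 * p.derivative.derivative.eval (y 0) * y 0 + 2 * p.derivative.eval (y 0)) * (e i * y i)
      + (p.derivative.derivative.eval (y 0) * y 0 ^ 2 + 3 * p.derivative.eval (y 0) * y 0) * y i ^ 2
      - p.derivative.eval (y 0) * y 0 := by ring
  simp only [hexp]
  rw [Finset.sum_sub_distrib, Finset.sum_add_distrib, Finset.sum_sub_distrib, ← Finset.mul_sum,
    ← Finset.mul_sum, ← Finset.mul_sum, hsum, he1, he2]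
  simp
  ring

end ZonalPolynomials

/-! ### Orthogonality, norms and neighbouring matrix coefficients -/

section ZonalIntegrals

open Polynomial

variable {n : ℕ}

theorem continuous_eval_coord (p : ℝ[X]) : Continuous fun x : Sph n => p.eval ((x : Euc n) 0) :=
  p.continuous.comp ((EuclideanSpace.proj 0 : Euc n →L[ℝ] ℝ).continuous.comp continuous_subtype_val)

theorem integrable_eval_coord (p : ℝ[X]) :
    Integrable (fun x : Sph n => p.eval ((x : Euc n) 0)) (surf n) :=
  (continuous_eval_coord p).integrable_of_hasCompactSupport (HasCompactSupport.of_compactSpace _)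

/-- The integral over the sphere of the zonal function given by a polynomial. -/
def zonalIntegral (n : ℕ) : ℝ[X] →ₗ[ℝ] ℝ where
  toFun p := ∫ x : Sph n, p.eval ((x : Euc n) 0) ∂(surf n)
  map_add' p q := by
    simp only [eval_add]
    exact integral_add (integrable_eval_coord p) (integrable_eval_coord q)
  map_smul' c p := by
    simp only [eval_smul, smul_eq_mul, RingHom.id_apply]
    exact integral_const_mul _ _

theorem zonalIntegral_apply (p : ℝ[X]) :
    zonalIntegral n p = ∫ x : Sph n, p.eval ((x : Euc n) 0) ∂(surf n) := rfl

theorem integral_zonalPoly_mul_conj (p q : ℝ[X]) :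
    ∫ x, zonalPoly n p x * conj (zonalPoly n q x) ∂(surf n) = (zonalIntegral n (p * q) : ℂ) := by
  rw [zonalIntegral_apply, ← integral_complex_ofReal]
  simp [zonalPoly]

/-- The Laplace–Beltrami operator on zonal polynomials. -/
def zonalLaplacian (n : ℕ) (p : ℝ[X]) : ℝ[X] :=
  (1 - X ^ 2) * derivative (derivative p) - (n : ℝ[X]) * X * derivative p

theorem lbInner_zonalPoly (p q : ℝ[X]) :
    lbInner (zonalPoly n p) (zonalPoly n q) = -(zonalIntegral n (zonalLaplacian n p * q) : ℂ) := by
  rw [lbInner, laplaceBeltrami_zonalPoly, ← integral_zonalPoly_mul_conj]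
  rfl

theorem zonalIntegral_zonalLaplacian_mul (p q : ℝ[X]) :
    zonalIntegral n (zonalLaplacian n p * q) = zonalIntegral n (zonalLaplacian n q * p) := by
  have h := lbInner_conj_symm (isC2_zonalPoly (n := n) p) (isC2_zonalPoly (n := n) q)
  rw [lbInner_zonalPoly, lbInner_zonalPoly, map_neg, Complex.conj_ofReal, neg_inj] at h
  exact_mod_cast h

/-- Symmetry tested against the constant `1`, which the Laplacian kills. -/
theorem zonalIntegral_zonalLaplacian (p : ℝ[X]) :
    zonalIntegral n (zonalLaplacian n p) = 0 := by
  have h := zonalIntegral_zonalLaplacian_mul (n := n) p 1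
  simpa [zonalLaplacian] using h

theorem two_mul_lam (n : ℕ) : 2 * lam n = (n : ℝ) - 1 := by rw [lam]; ring

theorem lam_pos (hn : 2 ≤ n) : 0 < lam n := by
  have : (2 : ℝ) ≤ n := by exact_mod_cast hn
  rw [lam]; linarith

/-- This is the Gegenbauer equation, since `n = 2λ + 1`. -/
theorem zonalLaplacian_gegPoly (l : ℕ) :
    zonalLaplacian n (gegPoly (lam n) l) = -((l : ℝ) * (l + 2 * lam n)) • gegPoly (lam n) l := by
  have h := gegPoly_ode (lam n) l
  have hn : (n : ℝ[X]) = 2 * C (lam n) + 1 := by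
    have : (n : ℝ) = 2 * lam n + 1 := by rw [two_mul_lam]; ring
    rw [← map_natCast C, this]
    simp [map_ofNat C 2]
  have hl : C (-((l : ℝ) * (l + 2 * lam n))) = -((l : ℝ[X]) * (l + 2 * C (lam n))) := by
    simp [map_ofNat C 2]
  rw [zonalLaplacian, smul_eq_C_mul, hl, hn]
  linear_combination h

/-- Orthogonality of the Gegenbauer polynomials. -/
theorem zonalIntegral_gegPoly_mul_of_ne (hn : 2 ≤ n) {l m : ℕ} (hlm : l ≠ m) :
    zonalIntegral n (gegPoly (lam n) l * gegPoly (lam n) m) = 0 := by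
  have h := zonalIntegral_zonalLaplacian_mul (n := n) (gegPoly (lam n) l) (gegPoly (lam n) m)
  rw [zonalLaplacian_gegPoly, zonalLaplacian_gegPoly, smul_mul_assoc, smul_mul_assoc, map_smul,
    map_smul, mul_comm (gegPoly (lam n) m), smul_eq_mul, smul_eq_mul] at h
  have h0 : (((l : ℝ) - m) * (l + m + 2 * lam n)) *
      zonalIntegral n (gegPoly (lam n) l * gegPoly (lam n) m) = 0 := by linear_combination -h
  refine (mul_eq_zero.1 h0).resolve_left (mul_ne_zero ?_ ?_)
  · rw [sub_ne_zero]; exact_mod_cast hlm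
  · have := lam_pos hn; positivity

/-- The squared `L²` norm of the zonal Gegenbauer polynomial. -/
def gegNormSq (n l : ℕ) : ℝ := zonalIntegral n (gegPoly (lam n) l * gegPoly (lam n) l)

/-- The matrix coefficient of the multiplication by the coordinate between consecutive
Gegenbauer polynomials. -/
def gegCross (n l : ℕ) : ℝ := zonalIntegral n (X * gegPoly (lam n) l * gegPoly (lam n) (l + 1))

theorem gegPoly_rec_smul (μ : ℝ) (l : ℕ) :
    (2 * ((l : ℝ) + 1 + μ)) • (X * gegPoly μ (l + 1)) =
      ((l : ℝ) + 2) • gegPoly μ (l + 2) + ((l : ℝ) + 2 * μ) • gegPoly μ l := by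
  have h := gegPoly_rec μ l
  simp only [smul_eq_C_mul, C_add, C_mul, C_1, map_natCast, map_ofNat]
  linear_combination -h

theorem gegPoly_rec_zero (μ : ℝ) : (2 * μ) • (X * gegPoly μ 0) = gegPoly μ 1 := by
  rw [gegPoly, gegPoly, smul_eq_C_mul, mul_one]

/-- Pair the recurrence with its lowest polynomial; orthogonality removes the highest one. -/
theorem gegCross_eq_left (hn : 2 ≤ n) (l : ℕ) :
    2 * ((l : ℝ) + 1 + lam n) * gegCross n l = ((l : ℝ) + 2 * lam n) * gegNormSq n l := by
  have h := congrArg (fun p => zonalIntegral n (p * gegPoly (lam n) l))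
    (gegPoly_rec_smul (lam n) l)
  simp only [add_mul, smul_mul_assoc, map_add, map_smul, smul_eq_mul] at h
  rw [zonalIntegral_gegPoly_mul_of_ne hn (by omega : l + 2 ≠ l)] at h
  rw [mul_right_comm X (gegPoly (lam n) (l + 1))] at h
  rw [gegCross, gegNormSq]
  linear_combination h

/-- Pair the recurrence with its highest polynomial; orthogonality removes the lowest one. Degree
zero uses the separate initial relation. -/
theorem gegCross_eq_right (hn : 2 ≤ n) (l : ℕ) :
    2 * ((l : ℝ) + lam n) * gegCross n l = ((l : ℝ) + 1) * gegNormSq n (l + 1) := by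
  cases l with
  | zero =>
    have h := congrArg (fun p => zonalIntegral n (p * gegPoly (lam n) 1))
      (gegPoly_rec_zero (lam n))
    simp only [smul_mul_assoc, map_smul, smul_eq_mul] at h
    rw [gegCross, gegNormSq, ← h]
    simp
  | succ l =>
    have h := congrArg (fun p => zonalIntegral n (p * gegPoly (lam n) (l + 2)))
      (gegPoly_rec_smul (lam n) l)
    simp only [add_mul, smul_mul_assoc, map_add, map_smul, smul_eq_mul] at h
    rw [zonalIntegral_gegPoly_mul_of_ne hn (by omega : l ≠ l + 2)] at h
    rw [gegCross, gegNormSq]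
    push_cast
    linear_combination h

/-- The total mass of the sphere. -/
def sphMass (n : ℕ) : ℝ := (surf n).real Set.univ

theorem sphMass_pos (n : ℕ) : 0 < sphMass n := by
  rw [sphMass, surf, Measure.toSphere_real_apply_univ]
  have : 0 < (volume : Measure (Euc n)).real (Metric.ball 0 1) :=
    ENNReal.toReal_pos (Metric.measure_ball_pos _ _ one_pos).ne' measure_ball_lt_top.ne
  have h2 : 0 < Module.finrank ℝ (Euc n) := by simp
  positivity

/-- Eliminating `gegCross` between the two preceding relations gives the ratio of consecutive norms;
the value at `l = 0` is the total mass. -/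
theorem gegNormSq_eq (hn : 2 ≤ n) (l : ℕ) :
    gegNormSq n l = sphMass n * (lam n / (l + lam n) * ((l + n - 2).choose l : ℝ)) := by
  have hl := lam_pos hn
  induction l with
  | zero => simp [gegNormSq, gegPoly, zonalIntegral_apply, sphMass, div_self hl.ne']
  | succ l ih =>
    have h1 := gegCross_eq_left hn l
    have h2 := gegCross_eq_right hn l
    -- The absorption identity for binomial coefficients, with `l + 2λ = l + n - 1`.
    have hc : ((l : ℝ) + 2 * lam n) * ((l + n - 2).choose l : ℝ) =
        ((l + 1 + n - 2).choose (l + 1) : ℝ) * (l + 1) := by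
      have := Nat.add_one_mul_choose_eq (l + n - 2) l
      rw [show l + n - 2 + 1 = l + 1 + n - 2 by omega] at this
      have h3 := congrArg (Nat.cast (R := ℝ)) this
      rw [show l + 1 + n - 2 = l + n - 1 by omega] at h3 ⊢
      rw [two_mul_lam]
      push_cast [Nat.cast_sub (show 1 ≤ l + n by omega)] at h3
      linear_combination h3
    have ha : (l : ℝ) + lam n ≠ 0 := by positivity
    have hb : (l : ℝ) + 1 + lam n ≠ 0 := by positivity
    have hc' : (l : ℝ) + 1 ≠ 0 := by positivity
    rw [ih] at h1
    push_cast
    have e : ((l : ℝ) + 1) * ((l + 1 + lam n) * gegNormSq n (l + 1)) =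
        ((l : ℝ) + 1) * (sphMass n * (lam n * ((l + 1 + n - 2).choose (l + 1) : ℝ))) := by
      have e1 : 2 * ((l : ℝ) + lam n) * (2 * (l + 1 + lam n) * gegCross n l) =
        2 * (sphMass n * lam n * ((l + 2 * lam n) * ((l + n - 2).choose l : ℝ))) := by
        rw [h1]; field_simp
      rw [hc] at e1
      linear_combination e1 / 2 - (l + 1 + lam n) * h2
    have e2 := mul_left_cancel₀ hc' e
    field_simp
    linear_combination e2

theorem gegNormSq_pos (hn : 2 ≤ n) (l : ℕ) : 0 < gegNormSq n l := by
  rw [gegNormSq_eq hn]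
  have h1 := lam_pos hn
  have h2 := sphMass_pos n
  have h3 : 0 < (l + n - 2).choose l := Nat.choose_pos (by omega)
  positivity

theorem gegCross_eq (hn : 2 ≤ n) (l : ℕ) :
    gegCross n l = sphMass n * (((l + n - 1).choose l : ℝ) * lam n ^ 2 /
      ((l + lam n) * (l + lam n + 1))) := by
  have hl := lam_pos hn
  have h1 := gegCross_eq_left hn l
  rw [gegNormSq_eq hn] at h1
  have hc : ((l : ℝ) + 2 * lam n) * ((l + n - 2).choose l : ℝ) =
      2 * lam n * ((l + n - 1).choose l : ℝ) := by
    have := Nat.choose_mul_succ_eq (l + n - 2) l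
    rw [show l + n - 2 + 1 = l + n - 1 by omega, show l + n - 1 - l = n - 1 by omega] at this
    have h3 := congrArg (Nat.cast (R := ℝ)) this
    rw [two_mul_lam]
    push_cast [Nat.cast_sub (show 1 ≤ l + n by omega), Nat.cast_sub (show 1 ≤ n by omega)] at h3
    linear_combination h3
  have ha : (l : ℝ) + lam n ≠ 0 := by positivity
  have hb : (l : ℝ) + lam n + 1 ≠ 0 := by positivity
  field_simp at h1 ⊢
  linear_combination h1 / 2 + sphMass n * lam n / 2 * hc

theorem gegCross_nonneg (hn : 2 ≤ n) (l : ℕ) : 0 ≤ gegCross n l := by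
  rw [gegCross_eq hn]
  have h1 := lam_pos hn
  have h2 := sphMass_pos n
  positivity

theorem gegCross_le_left (hn : 2 ≤ n) (l : ℕ) : gegCross n l ≤ gegNormSq n l := by
  have h := gegCross_eq_left hn l
  have h1 := lam_pos hn
  have h2 := gegNormSq_pos hn l
  have h3 : 0 < 2 * ((l : ℝ) + 1 + lam n) := by positivity
  refine le_of_mul_le_mul_left ?_ h3
  rw [h]
  have : (0 : ℝ) ≤ l := by positivity
  exact mul_le_mul_of_nonneg_right (by linarith) h2.le

/-- Amounts to `l + 1 ≤ 2 (l + λ)`, which holds because `2λ = n - 1 ≥ 1`. -/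
theorem gegCross_le_right (hn : 2 ≤ n) (l : ℕ) : gegCross n l ≤ gegNormSq n (l + 1) := by
  have h := gegCross_eq_right hn l
  have h1 := lam_pos hn
  have h2 := gegNormSq_pos hn (l + 1)
  have h3 : 0 < 2 * ((l : ℝ) + lam n) := by positivity
  refine le_of_mul_le_mul_left ?_ h3
  rw [h]
  have : (0 : ℝ) ≤ l := by positivity
  have h5 := two_mul_lam n
  have h6 : (2 : ℝ) ≤ n := by exact_mod_cast hn
  exact mul_le_mul_of_nonneg_right (by linarith) h2.le

end ZonalIntegrals

/-! ### The law of the coordinate is the Gegenbauer weight -/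

section CoordinateMeasure

open Polynomial

variable {n : ℕ}

/-- A functional vanishing on the range of the Laplacian vanishes on each Gegenbauer polynomial of
positive degree, whose eigenvalue is nonzero; these and `1` span all polynomials. -/
theorem linearMap_eq_of_zonalLaplacian (hn : 2 ≤ n) {J K : ℝ[X] →ₗ[ℝ] ℝ}
    (hJ : ∀ p, J (zonalLaplacian n p) = 0) (hK : ∀ p, K (zonalLaplacian n p) = 0)
    (h1 : J 1 = K 1) : J = K := by
  refine LinearMap.ext_on_range (span_gegPoly (lam_pos hn)) fun l => ?_
  cases l with
  | zero => exact h1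
  | succ l =>
    have key (T : ℝ[X] →ₗ[ℝ] ℝ) (hT : ∀ p, T (zonalLaplacian n p) = 0) :
        T (gegPoly (lam n) (l + 1)) = 0 := by
      have h := hT (gegPoly (lam n) (l + 1))
      rw [zonalLaplacian_gegPoly, map_smul, smul_eq_mul] at h
      refine (mul_eq_zero.1 h).resolve_left (neg_ne_zero.2 ?_)
      have := lam_pos hn
      positivity
    rw [key J hJ, key K hK]

theorem integrable_polynomial_of_ae_mem_Icc {m : Measure ℝ} [IsFiniteMeasure m]
    (hm : ∀ᵐ t ∂m, t ∈ Set.Icc (-1 : ℝ) 1) (p : ℝ[X]) : Integrable (fun t => p.eval t) m := by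
  obtain ⟨C, hC⟩ := isCompact_Icc.exists_bound_of_continuousOn
    (p.continuous.continuousOn (s := Set.Icc (-1 : ℝ) 1))
  refine Integrable.of_bound p.continuous.aestronglyMeasurable C ?_
  filter_upwards [hm] with t ht using hC t ht

/-- Finite measures on `[-1, 1]` are determined by the integrals of polynomials. -/
theorem measure_eq_of_integral_polynomial {μ ν : Measure ℝ} [IsFiniteMeasure μ] [IsFiniteMeasure ν]
    (hμ : ∀ᵐ t ∂μ, t ∈ Set.Icc (-1 : ℝ) 1) (hν : ∀ᵐ t ∂ν, t ∈ Set.Icc (-1 : ℝ) 1)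
    (h : ∀ p : ℝ[X], ∫ t, p.eval t ∂μ = ∫ t, p.eval t ∂ν) : μ = ν := by
  refine ext_of_forall_integral_eq_of_IsFiniteMeasure fun f => ?_
  have hp (m : Measure ℝ) [IsFiniteMeasure m] (hm : ∀ᵐ t ∂m, t ∈ Set.Icc (-1 : ℝ) 1)
      (p : ℝ[X]) (ε : ℝ) (hpε : ∀ t ∈ Set.Icc (-1 : ℝ) 1, |p.eval t - f t| < ε) :
      |∫ t, p.eval t ∂m - ∫ t, f t ∂m| ≤ ε * m.real Set.univ := by
    have hint := integrable_polynomial_of_ae_mem_Icc hm p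
    rw [← integral_sub hint (f.integrable m), ← Real.norm_eq_abs]
    refine norm_integral_le_of_norm_le_const ?_
    filter_upwards [hm] with t ht using (hpε t ht).le
  refine eq_of_abs_sub_le_all fun ε hε => ?_
  set M := μ.real Set.univ + ν.real Set.univ + 1 with hM
  have hM0 : 0 < M := by positivity
  obtain ⟨p, hpf⟩ := exists_polynomial_near_of_continuousOn (-1) 1 f f.continuous.continuousOn
    (ε / M) (by positivity)
  have e1 := hp μ hμ p _ hpf
  have e2 := hp ν hν p _ hpf
  rw [h p] at e1
  have e3 : |∫ t, f t ∂μ - ∫ t, f t ∂ν| ≤ ε / M * μ.real Set.univ + ε / M * ν.real Set.univ := by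
    rw [abs_le] at e1 e2 ⊢
    constructor <;> linarith [e1.1, e1.2, e2.1, e2.2]
  refine e3.trans ?_
  rw [← mul_add, div_mul_eq_mul_div, div_le_iff₀ hM0]
  exact mul_le_mul_of_nonneg_left (by linarith) hε.le

/-- The distribution of the coordinate `⟨ê, x⟩` under the surface measure. -/
def coordMeasure (n : ℕ) : Measure ℝ := (surf n).map fun x : Sph n => (x : Euc n) 0

theorem continuous_coord : Continuous fun x : Sph n => (x : Euc n) 0 :=
  (EuclideanSpace.proj 0 : Euc n →L[ℝ] ℝ).continuous.comp continuous_subtype_val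

instance : IsFiniteMeasure (coordMeasure n) := by unfold coordMeasure; infer_instance

theorem coord_mem_Icc (x : Sph n) : (x : Euc n) 0 ∈ Set.Icc (-1 : ℝ) 1 := by
  have h := PiLp.norm_apply_le (x : Euc n) 0
  rw [norm_eq_of_mem_sphere, Real.norm_eq_abs] at h
  exact abs_le.1 h

theorem ae_coordMeasure_mem_Icc : ∀ᵐ t ∂coordMeasure n, t ∈ Set.Icc (-1 : ℝ) 1 := by
  exact (ae_map_iff (p := fun t : ℝ => t ∈ Set.Icc (-1 : ℝ) 1) continuous_coord.aemeasurable
    measurableSet_Icc).2 (Eventually.of_forall coord_mem_Icc)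

theorem integral_coordMeasure_polynomial (p : ℝ[X]) :
    ∫ t, p.eval t ∂coordMeasure n = zonalIntegral n p := by
  rw [coordMeasure, integral_map continuous_coord.aemeasurable p.continuous.aestronglyMeasurable]
  rfl

/-- The Gegenbauer weight. -/
def gegWeight (n : ℕ) (t : ℝ) : ℝ := (1 - t ^ 2) ^ (lam n - 1 / 2)

theorem lam_sub_half (n : ℕ) : lam n - 1 / 2 = (n : ℝ) / 2 - 1 := by rw [lam]; ring

theorem continuous_gegWeight (hn : 2 ≤ n) : Continuous (gegWeight n) := by
  have : (2 : ℝ) ≤ n := by exact_mod_cast hn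
  exact Continuous.rpow_const (by fun_prop) fun t => Or.inr (by rw [lam_sub_half]; linarith)

theorem one_sub_sq_nonneg {t : ℝ} (ht : t ∈ Set.Icc (-1 : ℝ) 1) : 0 ≤ 1 - t ^ 2 := by
  nlinarith [ht.1, ht.2]

theorem gegWeight_nonneg {t : ℝ} (ht : t ∈ Set.Icc (-1 : ℝ) 1) : 0 ≤ gegWeight n t :=
  Real.rpow_nonneg (one_sub_sq_nonneg ht) _

/-- The measure on `[-1, 1]` with the Gegenbauer weight as its density. -/
def weightMeasure (n : ℕ) : Measure ℝ :=
  (volume.restrict (Set.Icc (-1 : ℝ) 1)).withDensity fun t => ENNReal.ofReal (gegWeight n t)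

theorem isFiniteMeasure_weightMeasure (hn : 2 ≤ n) : IsFiniteMeasure (weightMeasure n) :=
  isFiniteMeasure_withDensity_ofReal
    ((continuous_gegWeight hn).continuousOn.integrableOn_compact isCompact_Icc).2

theorem integral_weightMeasure (hn : 2 ≤ n) {E : Type*} [NormedAddCommGroup E] [NormedSpace ℝ E]
    (g : ℝ → E) : ∫ t, g t ∂weightMeasure n = ∫ t in (-1 : ℝ)..1, gegWeight n t • g t := by
  rw [weightMeasure]
  simp only [ENNReal.ofReal]
  rw [integral_withDensity_eq_integral_smul (continuous_gegWeight hn).measurable.real_toNNReal,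
    intervalIntegral.integral_of_le (by norm_num), ← integral_Icc_eq_integral_Ioc]
  refine setIntegral_congr_fun measurableSet_Icc fun t ht => ?_
  simp only [NNReal.smul_def]
  rw [Real.coe_toNNReal _ (gegWeight_nonneg ht)]

/-- In divergence form, the weight times the Laplacian of `p` is the derivative of `p' (1 -
t²)^(n/2)`, which vanishes at both endpoints. -/
theorem integral_weightMeasure_zonalLaplacian (hn : 2 ≤ n) (p : ℝ[X]) :
    ∫ t, (zonalLaplacian n p).eval t ∂weightMeasure n = 0 := by
  have hn' : (2 : ℝ) ≤ n := by exact_mod_cast hn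
  have hd (t : ℝ) (ht : t ∈ Set.uIcc (-1 : ℝ) 1) :
      HasDerivAt (fun t : ℝ => p.derivative.eval t * (1 - t ^ 2) ^ ((n : ℝ) / 2))
        (gegWeight n t • (zonalLaplacian n p).eval t) t := by
    rw [Set.uIcc_of_le (by norm_num)] at ht
    have h0 : HasDerivAt (fun t : ℝ => 1 - t ^ 2) (-(2 * t)) t := by
      simpa using ((hasDerivAt_id t).pow 2).const_sub 1
    have h1 := h0.rpow_const (p := (n : ℝ) / 2) (Or.inr (by linarith))
    have h2 := (p.derivative.hasDerivAt t).mul h1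
    refine HasDerivAt.congr_deriv (f := fun t : ℝ => p.derivative.eval t *
      (1 - t ^ 2) ^ ((n : ℝ) / 2)) h2 ?_
    -- At `t = ±1` the base is zero, so the exponent rule relies on the nonvanishing of the total
    -- exponent `n / 2`.
    have hpow : (1 - t ^ 2) ^ ((n : ℝ) / 2) = gegWeight n t * (1 - t ^ 2) := by
      rw [gegWeight, lam_sub_half, ← Real.rpow_add_one' (one_sub_sq_nonneg ht) (by
        rw [sub_add_cancel]; linarith), sub_add_cancel]
    rw [hpow, ← lam_sub_half]
    change _ + _ * (_ * _ * gegWeight n t) = _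
    simp [zonalLaplacian]
    ring
  rw [integral_weightMeasure hn, intervalIntegral.integral_eq_sub_of_hasDerivAt hd]
  · have : (n : ℝ) / 2 ≠ 0 := by linarith
    simp [Real.zero_rpow this]
  · exact ((continuous_gegWeight hn).smul (zonalLaplacian n p).continuous).intervalIntegrable _ _

theorem weightMeasure_real_univ_pos (hn : 2 ≤ n) : 0 < (weightMeasure n).real Set.univ := by
  have h := integral_weightMeasure hn (fun _ => (1 : ℝ))
  simp only [integral_const, smul_eq_mul, mul_one] at h
  rw [h]
  refine intervalIntegral.intervalIntegral_pos_of_pos_on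
    ((continuous_gegWeight hn).intervalIntegrable _ _) (fun t ht => ?_) (by norm_num)
  exact Real.rpow_pos_of_pos (by nlinarith [ht.1, ht.2]) _

theorem ae_weightMeasure_mem_Icc : ∀ᵐ t ∂weightMeasure n, t ∈ Set.Icc (-1 : ℝ) 1 :=
  (withDensity_absolutelyContinuous _ _).ae_le (ae_restrict_mem measurableSet_Icc)

/-- The ratio of the coordinate measure and the Gegenbauer weight. -/
def weightRatio (n : ℕ) : NNReal := (sphMass n / (weightMeasure n).real Set.univ).toNNReal

theorem weightRatio_pos (hn : 2 ≤ n) : 0 < weightRatio n :=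
  Real.toNNReal_pos.2 (div_pos (sphMass_pos n) (weightMeasure_real_univ_pos hn))

/-- The coordinate `⟨ê, x⟩` is distributed according to the Gegenbauer weight. -/
theorem coordMeasure_eq (hn : 2 ≤ n) : coordMeasure n = weightRatio n • weightMeasure n := by
  have := isFiniteMeasure_weightMeasure hn
  refine measure_eq_of_integral_polynomial ae_coordMeasure_mem_Icc
    (Measure.ae_smul_measure ae_weightMeasure_mem_Icc _) fun p => ?_
  rw [integral_coordMeasure_polynomial, integral_smul_nnreal_measure, NNReal.smul_def]
  let K : ℝ[X] →ₗ[ℝ] ℝ := 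
    { toFun := fun p => (weightRatio n : ℝ) • ∫ t, p.eval t ∂weightMeasure n
      map_add' := fun p q => by
        simp only [eval_add]
        rw [integral_add (integrable_polynomial_of_ae_mem_Icc ae_weightMeasure_mem_Icc p)
          (integrable_polynomial_of_ae_mem_Icc ae_weightMeasure_mem_Icc q), smul_add]
      map_smul' := fun c p => by
        simp only [eval_smul, smul_eq_mul, RingHom.id_apply, integral_const_mul]
        ring }
  have h : zonalIntegral n = K := by
    refine linearMap_eq_of_zonalLaplacian hn zonalIntegral_zonalLaplacian (fun p => ?_) ?_
    · change (weightRatio n : ℝ) • ∫ t, (zonalLaplacian n p).eval t ∂weightMeasure n = 0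
      rw [integral_weightMeasure_zonalLaplacian hn, smul_zero]
    · change zonalIntegral n 1 = (weightRatio n : ℝ) • ∫ t, (1 : ℝ[X]).eval t ∂weightMeasure n
      have hw := weightMeasure_real_univ_pos hn
      rw [weightRatio, Real.coe_toNNReal _ (div_pos (sphMass_pos n) hw).le, zonalIntegral_apply]
      simp only [eval_one, integral_const, smul_eq_mul, mul_one]
      rw [div_mul_cancel₀ _ hw.ne', sphMass]
  exact congrArg (fun T : ℝ[X] →ₗ[ℝ] ℝ => T p) h

theorem aestronglyMeasurable_coordMeasure (hn : 2 ≤ n) {F : ℝ → ℂ}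
    (hF : AEStronglyMeasurable F (volume.restrict (Set.Icc (-1 : ℝ) 1))) :
    AEStronglyMeasurable F (coordMeasure n) := by
  rw [coordMeasure_eq hn]
  exact (hF.mono_ac (withDensity_absolutelyContinuous _ _)).smul_measure _

/-- The Gegenbauer coefficients as integrals over the sphere. -/
theorem gegenbauerCoeff_eq (hn : 2 ≤ n) (F : ℝ → ℂ) (l : ℕ) :
    gegenbauerCoeff n F l = (gegNormSq n l : ℂ)⁻¹ *
      ∫ t, F t * (((gegPoly (lam n) l).eval t : ℝ) : ℂ) ∂coordMeasure n := by
  -- Numerator and denominator of the coefficient both change by the factor `weightRatio n`, so its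
  -- value is irrelevant.
  have hc : (weightRatio n : ℝ) ≠ 0 := by exact_mod_cast (weightRatio_pos hn).ne'
  have h1 : gegNormSq n l = weightRatio n * ∫ t in (-1 : ℝ)..1,
      gegenbauer (lam n) l t ^ 2 * (1 - t ^ 2) ^ (lam n - 1 / 2) := by
    rw [gegNormSq, ← integral_coordMeasure_polynomial, coordMeasure_eq hn,
      integral_smul_nnreal_measure, integral_weightMeasure hn, NNReal.smul_def, smul_eq_mul]
    congr 2
    ext t
    rw [gegenbauer_eq_eval, eval_mul, gegWeight, smul_eq_mul]
    ring
  have h2 : ∫ t, F t * (((gegPoly (lam n) l).eval t : ℝ) : ℂ) ∂coordMeasure n =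
      weightRatio n * ∫ t in (-1 : ℝ)..1,
        F t * (gegenbauer (lam n) l t : ℂ) * (((1 - t ^ 2) ^ (lam n - 1 / 2) : ℝ) : ℂ) := by
    rw [coordMeasure_eq hn, integral_smul_nnreal_measure, integral_weightMeasure hn,
      NNReal.smul_def, Complex.real_smul]
    congr 2
    ext t
    rw [gegenbauer_eq_eval, gegWeight, Complex.real_smul]
    ring
  rw [gegenbauerCoeff, h1, h2]
  have hc' : ((weightRatio n : ℝ) : ℂ) ≠ 0 := by exact_mod_cast hc
  push_cast
  rw [mul_inv]
  field_simp

end CoordinateMeasure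

/-! ### Gegenbauer expansion and Parseval sums -/

section Expansion

open Polynomial

variable {n : ℕ}

theorem memLp_polynomial (p : ℝ[X]) :
    MemLp (fun t => ((p.eval t : ℝ) : ℂ)) 2 (coordMeasure n) := by
  obtain ⟨C, hC⟩ := isCompact_Icc.exists_bound_of_continuousOn
    (p.continuous.continuousOn (s := Set.Icc (-1 : ℝ) 1))
  refine MemLp.of_bound (Complex.continuous_ofReal.comp p.continuous).aestronglyMeasurable C ?_
  filter_upwards [ae_coordMeasure_mem_Icc] with t ht
  simpa using hC t ht

/-- A real polynomial as an element of `L²` of the coordinate measure. -/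
def polyLp (n : ℕ) (p : ℝ[X]) : Lp ℂ 2 (coordMeasure n) := (memLp_polynomial p).toLp _

theorem coeFn_polyLp (p : ℝ[X]) :
    polyLp n p =ᵐ[coordMeasure n] fun t => ((p.eval t : ℝ) : ℂ) := MemLp.coeFn_toLp _

theorem inner_polyLp (p : ℝ[X]) (u : Lp ℂ 2 (coordMeasure n)) :
    inner ℂ (polyLp n p) u = ∫ t, u t * ((p.eval t : ℝ) : ℂ) ∂coordMeasure n := by
  rw [L2.inner_def]
  refine integral_congr_ae ?_
  filter_upwards [coeFn_polyLp p] with t ht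
  rw [ht]
  simp

theorem inner_polyLp_polyLp (p q : ℝ[X]) :
    inner ℂ (polyLp n p) (polyLp n q) = (zonalIntegral n (p * q) : ℂ) := by
  rw [inner_polyLp, ← integral_coordMeasure_polynomial, ← integral_complex_ofReal]
  refine integral_congr_ae ?_
  filter_upwards [coeFn_polyLp q] with t ht
  rw [ht, eval_mul]
  push_cast
  ring

theorem polyLp_add (p q : ℝ[X]) : polyLp n (p + q) = polyLp n p + polyLp n q := by
  rw [polyLp, polyLp, polyLp, ← MemLp.toLp_add]
  congr 1
  ext t
  simp

theorem polyLp_smul (c : ℝ) (p : ℝ[X]) : polyLp n (c • p) = (c : ℂ) • polyLp n p := by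
  rw [polyLp, polyLp, ← MemLp.toLp_const_smul]
  congr 1
  ext t
  simp

/-- Completeness from Weierstrass: a smooth test function is uniformly close to a polynomial on
`[-1, 1]`, which carries the measure, and `u` is integrable. -/
theorem eq_zero_of_inner_polyLp {u : Lp ℂ 2 (coordMeasure n)}
    (h : ∀ p, inner ℂ (polyLp n p) u = 0) : u = 0 := by
  have hui : Integrable u (coordMeasure n) := (Lp.memLp u).integrable (by norm_num)
  rw [Lp.eq_zero_iff_ae_eq_zero]
  refine ae_eq_zero_of_integral_contDiff_smul_eq_zero hui.locallyIntegrable fun g hg _ => ?_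
  set M := ∫ t, ‖u t‖ ∂coordMeasure n with hM
  have hM0 : 0 ≤ M := integral_nonneg fun _ => norm_nonneg _
  rw [← norm_le_zero_iff]
  refine le_of_forall_pos_le_add fun ε hε => ?_
  obtain ⟨p, hp⟩ := exists_polynomial_near_of_continuousOn (-1) 1 g hg.continuous.continuousOn
    (ε / (M + 1)) (by positivity)
  have hpu := h p
  rw [inner_polyLp] at hpu
  have hbd {q : ℝ → ℝ} (hq : Continuous q) : Integrable (fun t => q t • u t) (coordMeasure n) := by
    obtain ⟨C, hC⟩ := isCompact_Icc.exists_bound_of_continuousOn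
      (hq.continuousOn (s := Set.Icc (-1 : ℝ) 1))
    refine hui.bdd_smul C hq.aestronglyMeasurable ?_
    filter_upwards [ae_coordMeasure_mem_Icc] with t ht using hC t ht
  have hp0 : ∫ t, p.eval t • u t ∂coordMeasure n = 0 := by
    rw [← hpu]
    congr 1
    ext t
    rw [Complex.real_smul, mul_comm]
  have e : ∫ t, g t • u t ∂coordMeasure n = ∫ t, (g t - p.eval t) • u t ∂coordMeasure n := by
    simp only [sub_smul]
    rw [integral_sub (hbd hg.continuous) (hbd p.continuous), hp0, sub_zero]
  rw [e, zero_add]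
  calc ‖∫ t, (g t - p.eval t) • u t ∂coordMeasure n‖
      ≤ ∫ t, ε / (M + 1) * ‖u t‖ ∂coordMeasure n := by
        refine norm_integral_le_of_norm_le (hui.norm.const_mul _) ?_
        filter_upwards [ae_coordMeasure_mem_Icc] with t ht
        rw [norm_smul, Real.norm_eq_abs, abs_sub_comm]
        exact mul_le_mul_of_nonneg_right (hp t ht).le (norm_nonneg _)
    _ = ε / (M + 1) * M := by rw [integral_const_mul]
    _ ≤ ε := by
        rw [div_mul_eq_mul_div, div_le_iff₀ (by positivity)]
        exact mul_le_mul_of_nonneg_left (by linarith) hε.le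

/-- The normalized Gegenbauer polynomials. -/
def gegLp (n l : ℕ) : Lp ℂ 2 (coordMeasure n) :=
  (((√(gegNormSq n l))⁻¹ : ℝ) : ℂ) • polyLp n (gegPoly (lam n) l)

theorem orthonormal_gegLp (hn : 2 ≤ n) : Orthonormal ℂ (gegLp n) := by
  rw [orthonormal_iff_ite]
  intro l m
  rw [gegLp, gegLp, inner_smul_left, inner_smul_right, inner_polyLp_polyLp, Complex.conj_ofReal]
  split_ifs with h
  · subst h
    have h1 := gegNormSq_pos hn l
    have h2 := Real.mul_self_sqrt h1.le
    have h3 : √(gegNormSq n l) ≠ 0 := (Real.sqrt_pos.2 h1).ne'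
    norm_cast
    change _ * (_ * gegNormSq n l) = 1
    nth_rw 3 [← h2]
    field_simp
  · rw [zonalIntegral_gegPoly_mul_of_ne hn h]
    simp

theorem span_gegLp_orthogonal (hn : 2 ≤ n) :
    (Submodule.span ℂ (Set.range (gegLp n)))ᗮ = ⊥ := by
  rw [Submodule.eq_bot_iff]
  intro u hu
  rw [Submodule.mem_orthogonal] at hu
  refine eq_zero_of_inner_polyLp fun p => ?_
  have hp : p ∈ Submodule.span ℝ (Set.range (gegPoly (lam n))) := by
    rw [span_gegPoly (lam_pos hn)]; trivial
  induction hp using Submodule.span_induction with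
  | zero => simp [inner_polyLp]
  | add p q _ _ hp hq => rw [polyLp_add, inner_add_left, hp, hq, add_zero]
  | smul c p _ hp => rw [polyLp_smul, inner_smul_left, hp, mul_zero]
  | mem p hp =>
    obtain ⟨l, rfl⟩ := hp
    have h := hu _ (Submodule.subset_span ⟨l, rfl⟩)
    rw [gegLp, inner_smul_left] at h
    refine (mul_eq_zero.1 h).resolve_left ?_
    rw [Complex.conj_ofReal]
    exact_mod_cast inv_ne_zero (Real.sqrt_pos.2 (gegNormSq_pos hn l)).ne'

/-- The normalized Gegenbauer polynomials as a Hilbert basis. -/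
def gegBasis (hn : 2 ≤ n) : HilbertBasis ℕ ℂ (Lp ℂ 2 (coordMeasure n)) :=
  HilbertBasis.mkOfOrthogonalEqBot (orthonormal_gegLp hn) (span_gegLp_orthogonal hn)

theorem gegBasis_apply (hn : 2 ≤ n) (l : ℕ) : gegBasis hn l = gegLp n l := by
  simp [gegBasis]

variable {F : ℝ → ℂ}

theorem integral_mul_gegPoly (hn : 2 ≤ n) (F : ℝ → ℂ) (l : ℕ) :
    ∫ t, F t * (((gegPoly (lam n) l).eval t : ℝ) : ℂ) ∂coordMeasure n =
      gegNormSq n l * gegenbauerCoeff n F l := by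
  have : (gegNormSq n l : ℂ) ≠ 0 := by exact_mod_cast (gegNormSq_pos hn l).ne'
  rw [gegenbauerCoeff_eq hn, mul_inv_cancel_left₀ this]

theorem inner_polyLp_toLp (hF : MemLp F 2 (coordMeasure n)) (p : ℝ[X]) :
    inner ℂ (polyLp n p) (hF.toLp F) = ∫ t, F t * ((p.eval t : ℝ) : ℂ) ∂coordMeasure n := by
  rw [inner_polyLp]
  refine integral_congr_ae ?_
  filter_upwards [hF.coeFn_toLp] with t ht
  rw [ht]

theorem inner_gegLp_toLp (hn : 2 ≤ n) (hF : MemLp F 2 (coordMeasure n)) (l : ℕ) :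
    inner ℂ (gegLp n l) (hF.toLp F) = (√(gegNormSq n l) : ℂ) * gegenbauerCoeff n F l := by
  have h1 := gegNormSq_pos hn l
  have h3 : ((√(gegNormSq n l) : ℝ) : ℂ) ≠ 0 := by exact_mod_cast (Real.sqrt_pos.2 h1).ne'
  have h2 : ((√(gegNormSq n l) : ℝ) : ℂ) * (√(gegNormSq n l) : ℝ) = gegNormSq n l := by
    exact_mod_cast Real.mul_self_sqrt h1.le
  rw [gegLp, inner_smul_left, inner_polyLp_toLp, integral_mul_gegPoly hn, Complex.conj_ofReal, ← h2]
  push_cast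
  field_simp

/-- The Gegenbauer expansion converges in `L²`. -/
theorem tendsto_gegenbauer_expansion (hn : 2 ≤ n) (hF : MemLp F 2 (coordMeasure n)) :
    Tendsto (fun N : ℕ => eLpNorm (F - fun t => ∑ l ∈ Finset.range N,
      gegenbauerCoeff n F l * (gegenbauer (lam n) l t : ℂ)) 2 (coordMeasure n)) atTop (𝓝 0) := by
  have h := ((gegBasis hn).hasSum_repr (hF.toLp F)).tendsto_sum_nat
  have hterm (l : ℕ) : (gegBasis hn).repr (hF.toLp F) l • gegBasis hn l =
      gegenbauerCoeff n F l • polyLp n (gegPoly (lam n) l) := by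
    have h1 := gegNormSq_pos hn l
    have h3 : ((√(gegNormSq n l) : ℝ) : ℂ) ≠ 0 := by exact_mod_cast (Real.sqrt_pos.2 h1).ne'
    rw [HilbertBasis.repr_apply_apply, gegBasis_apply, inner_gegLp_toLp hn, gegLp, smul_smul]
    congr 1
    push_cast
    field_simp
  simp only [hterm] at h
  have hm (N : ℕ) : MemLp (fun t => ∑ l ∈ Finset.range N,
      gegenbauerCoeff n F l * (gegenbauer (lam n) l t : ℂ)) 2 (coordMeasure n) := by
    simp only [gegenbauer_eq_eval]
    exact memLp_finsetSum _ fun l _ => (memLp_polynomial _).const_mul _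
  have hL (N : ℕ) : ∑ l ∈ Finset.range N, gegenbauerCoeff n F l • polyLp n (gegPoly (lam n) l) =
      (hm N).toLp _ := by
    induction N with
    | zero =>
      simp only [Finset.range_zero, Finset.sum_empty]
      exact (MemLp.toLp_zero _).symm
    | succ N ih =>
      rw [Finset.sum_range_succ, ih, polyLp, ← MemLp.toLp_const_smul, ← MemLp.toLp_add]
      congr 1
      ext t
      simp [Finset.sum_range_succ, gegenbauer_eq_eval]
  simp only [hL] at h
  have h' := (tendsto_iff_edist_tendsto_0.1 h)
  refine h'.congr fun N => ?_
  rw [Lp.edist_toLp_toLp, eLpNorm_sub_comm]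

theorem hasSum_gegNormSq_mul (hn : 2 ≤ n) (hF : MemLp F 2 (coordMeasure n)) :
    HasSum (fun l => gegNormSq n l * ‖gegenbauerCoeff n F l‖ ^ 2)
      (∫ t, ‖F t‖ ^ 2 ∂coordMeasure n) := by
  have h := (gegBasis hn).hasSum_inner_mul_inner (hF.toLp F) (hF.toLp F)
  have h2 : inner ℂ (hF.toLp F) (hF.toLp F) = ((∫ t, ‖F t‖ ^ 2 ∂coordMeasure n : ℝ) : ℂ) := by
    rw [L2.inner_def, ← integral_complex_ofReal]
    refine integral_congr_ae ?_
    filter_upwards [hF.coeFn_toLp] with t ht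
    rw [ht, inner_self_eq_norm_sq_to_K]
    simp
  rw [h2] at h
  have hterm (l : ℕ) : inner ℂ (hF.toLp F) (gegBasis hn l) * inner ℂ (gegBasis hn l) (hF.toLp F)
      = ((gegNormSq n l * ‖gegenbauerCoeff n F l‖ ^ 2 : ℝ) : ℂ) := by
    rw [gegBasis_apply, ← inner_conj_symm, inner_gegLp_toLp hn, map_mul, Complex.conj_ofReal]
    have h4 : ((√(gegNormSq n l) : ℝ) : ℂ) * (√(gegNormSq n l) : ℝ) = gegNormSq n l := by
      exact_mod_cast Real.mul_self_sqrt (gegNormSq_pos hn l).le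
    have h5 := Complex.mul_conj' (gegenbauerCoeff n F l)
    push_cast
    rw [← h4, ← h5]
    ring
  simp only [hterm] at h
  exact Complex.hasSum_ofReal.1 h

theorem integral_mul_X_mul_gegPoly_zero (hn : 2 ≤ n) (hF : MemLp F 2 (coordMeasure n)) :
    ∫ t, F t * (((X * gegPoly (lam n) 0).eval t : ℝ) : ℂ) ∂coordMeasure n =
      gegCross n 0 * gegenbauerCoeff n F 1 := by
  have h := congrArg (fun p => inner ℂ (polyLp n p) (hF.toLp F)) (gegPoly_rec_zero (lam n))
  simp only [polyLp_smul, inner_smul_left, Complex.conj_ofReal] at h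
  rw [inner_polyLp_toLp, inner_polyLp_toLp, integral_mul_gegPoly hn] at h
  have hb := congrArg (fun r : ℝ => (r : ℂ)) (gegCross_eq_right hn 0)
  have hl : ((lam n : ℝ) : ℂ) ≠ 0 := by exact_mod_cast (lam_pos hn).ne'
  push_cast at h hb
  have h2 : (2 * (lam n : ℂ)) ≠ 0 := mul_ne_zero two_ne_zero hl
  apply mul_left_cancel₀ h2
  rw [h]
  simp only [zero_add, one_mul] at hb
  rw [← mul_assoc, hb]

/-- The recurrence inside the inner product; the two `gegCross` relations rewrite its coefficients
symmetrically, as a Jacobi matrix. -/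
theorem integral_mul_X_mul_gegPoly_succ (hn : 2 ≤ n) (hF : MemLp F 2 (coordMeasure n)) (l : ℕ) :
    ∫ t, F t * (((X * gegPoly (lam n) (l + 1)).eval t : ℝ) : ℂ) ∂coordMeasure n =
      gegCross n (l + 1) * gegenbauerCoeff n F (l + 2) + gegCross n l * gegenbauerCoeff n F l := by
  have h := congrArg (fun p => inner ℂ (polyLp n p) (hF.toLp F)) (gegPoly_rec_smul (lam n) l)
  simp only [polyLp_smul, polyLp_add, inner_add_left, inner_smul_left, Complex.conj_ofReal] at h
  rw [inner_polyLp_toLp, inner_polyLp_toLp, inner_polyLp_toLp, integral_mul_gegPoly hn,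
    integral_mul_gegPoly hn] at h
  have hb := congrArg (fun r : ℝ => (r : ℂ)) (gegCross_eq_right hn (l + 1))
  have hb' := congrArg (fun r : ℝ => (r : ℂ)) (gegCross_eq_left hn l)
  have hl : (2 * ((l : ℂ) + 1 + (lam n : ℝ))) ≠ 0 := by
    have := lam_pos hn
    have h0 : (2 * ((l : ℝ) + 1 + lam n)) ≠ 0 := by positivity
    exact_mod_cast h0
  push_cast at h hb hb'
  apply mul_left_cancel₀ hl
  linear_combination h - gegenbauerCoeff n F (l + 2) * hb - gegenbauerCoeff n F l * hb'

/-- `gegCross n l` is at most either neighbouring squared norm, so by the arithmetic–geometric mean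
inequality the terms are dominated by two Parseval series. -/
theorem summable_gegCross_mul (hn : 2 ≤ n) (hF : MemLp F 2 (coordMeasure n)) {p : ℕ → ℂ}
    (hp : ∀ l, ‖p l‖ = gegCross n l * (‖gegenbauerCoeff n F l‖ * ‖gegenbauerCoeff n F (l + 1)‖)) :
    Summable p := by
  have hs := (hasSum_gegNormSq_mul hn hF).summable
  have hs' := (summable_nat_add_iff 1).2 hs
  refine Summable.of_norm_bounded (hs.add hs') fun l => ?_
  rw [hp]
  have h1 := gegCross_le_left hn l
  have h2 := gegCross_le_right hn l
  have h0 := gegCross_nonneg hn l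
  have hx := sq_nonneg ‖gegenbauerCoeff n F l‖
  have hy := sq_nonneg ‖gegenbauerCoeff n F (l + 1)‖
  have e1 := mul_le_mul_of_nonneg_right h1 hx
  have e2 := mul_le_mul_of_nonneg_right h2 hy
  have e3 := mul_nonneg h0 (sq_nonneg (‖gegenbauerCoeff n F l‖ - ‖gegenbauerCoeff n F (l + 1)‖))
  have e4 := mul_nonneg h0 hx
  have e5 := mul_nonneg h0 hy
  nlinarith

/-- The expansion of the first moment of the coordinate. -/
theorem hasSum_gegCross_mul (hn : 2 ≤ n) (hF : MemLp F 2 (coordMeasure n)) :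
    HasSum (fun l => (gegCross n l : ℂ) *
      (conj (gegenbauerCoeff n F l) * gegenbauerCoeff n F (l + 1) +
        gegenbauerCoeff n F l * conj (gegenbauerCoeff n F (l + 1))))
      ((∫ t, t * ‖F t‖ ^ 2 ∂coordMeasure n : ℝ) : ℂ) := by
  set a := gegenbauerCoeff n F with ha
  have hX : MemLp (fun t : ℝ => (t : ℂ) * F t) 2 (coordMeasure n) := by
    refine MemLp.of_le hF
      (Complex.continuous_ofReal.aestronglyMeasurable.mul hF.aestronglyMeasurable) ?_
    filter_upwards [ae_coordMeasure_mem_Icc] with t ht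
    rw [norm_mul, Complex.norm_real, Real.norm_eq_abs]
    exact mul_le_of_le_one_left (norm_nonneg _) (abs_le.2 ht)
  -- Parseval for the pair `F`, `t F`; both lie in `L²` because `|t| ≤ 1` almost everywhere.
  have h := (gegBasis hn).hasSum_inner_mul_inner (hF.toLp F) (hX.toLp _)
  have h2 : inner ℂ (hF.toLp F) (hX.toLp _) =
      ((∫ t, t * ‖F t‖ ^ 2 ∂coordMeasure n : ℝ) : ℂ) := by
    rw [L2.inner_def, ← integral_complex_ofReal]
    refine integral_congr_ae ?_
    filter_upwards [hF.coeFn_toLp, hX.coeFn_toLp] with t ht ht'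
    rw [ht, ht']
    have := Complex.mul_conj' (F t)
    simp only [RCLike.inner_apply]
    push_cast
    rw [← this]
    ring
  rw [h2] at h
  set T : ℕ → ℂ := fun l =>
    ∫ t, F t * (((X * gegPoly (lam n) l).eval t : ℝ) : ℂ) ∂coordMeasure n with hT
  have hterm (l : ℕ) : inner ℂ (hF.toLp F) (gegBasis hn l) * inner ℂ (gegBasis hn l) (hX.toLp _)
      = conj (a l) * T l := by
    have h3 : ((√(gegNormSq n l) : ℝ) : ℂ) ≠ 0 := by
      exact_mod_cast (Real.sqrt_pos.2 (gegNormSq_pos hn l)).ne'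
    have h4 : ∫ t, (t : ℂ) * F t * (((gegPoly (lam n) l).eval t : ℝ) : ℂ) ∂coordMeasure n
        = T l := by
      rw [hT]
      congr 1
      ext t
      simp only [eval_mul, eval_X]
      push_cast
      ring
    rw [gegBasis_apply, ← inner_conj_symm, inner_gegLp_toLp hn, map_mul, Complex.conj_ofReal, gegLp,
      inner_smul_left, inner_polyLp_toLp, h4, Complex.conj_ofReal, ← ha]
    push_cast
    field_simp
  simp only [hterm] at h
  set P : ℕ → ℂ := fun l => gegCross n l * (conj (a l) * a (l + 1)) with hP
  set Q : ℕ → ℂ := fun l => gegCross n l * (a l * conj (a (l + 1))) with hQ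
  have hPs : Summable P := summable_gegCross_mul hn hF fun l => by
    simp [hP, abs_of_nonneg (gegCross_nonneg hn l), ha]
  have hQs : Summable Q := summable_gegCross_mul hn hF fun l => by
    simp [hQ, abs_of_nonneg (gegCross_nonneg hn l), ha]
  -- The `l`-th Parseval term is `P l + Q (l - 1)`, without `Q` at `l = 0`. Removing the summable
  -- `P` and shifting the index by one leaves the series of `Q`.
  have hsub := h.sub hPs.hasSum
  have hz := (hasSum_nat_add_iff' 1).2 hsub
  have h0 : conj (a 0) * T 0 = P 0 := by
    simp only [hT, hP]
    rw [integral_mul_X_mul_gegPoly_zero hn hF, ← ha]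
    ring
  have hs (l : ℕ) : conj (a (l + 1)) * T (l + 1) - P (l + 1) = Q l := by
    simp only [hT, hP, hQ]
    rw [integral_mul_X_mul_gegPoly_succ hn hF, ← ha]
    ring
  simp only [hs, Finset.range_one, Finset.sum_singleton, h0, sub_self, sub_zero] at hz
  have hfin := hPs.hasSum.add hz
  rw [add_sub_cancel] at hfin
  have hPQ : (fun l => P l + Q l) = fun l => (gegCross n l : ℂ) *
      (conj (a l) * a (l + 1) + a l * conj (a (l + 1))) := by
    ext l
    simp only [hP, hQ]
    ring
  rwa [hPQ] at hfin

end Expansion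

/-! ### The moment vector is parallel to the axis -/

section Moment

variable {n : ℕ}

theorem zonal_apply (F : ℝ → ℂ) (x : Sph n) : zonal n F x = F ((x : Euc n) 0) := by
  simp [zonal, PiLp.inner_apply]

theorem zonal_eq_comp (F : ℝ → ℂ) : zonal n F = F ∘ fun x : Sph n => (x : Euc n) 0 :=
  funext (zonal_apply F)

/-- Reflecting the `i`-th coordinate preserves Lebesgue measure and the zonal function but changes
the sign of the integrand. -/
theorem integral_norm_sq_zonal_mul_coord (F : ℝ → ℂ) {i : Fin (n + 1)} (hi : i ≠ 0) :
    ∫ x : Sph n, ‖zonal n F x‖ ^ 2 * (x : Euc n) i ∂surf n = 0 := by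
  set H : Euc n → ℂ := fun y => ((‖F (y 0 * ‖y‖⁻¹)‖ ^ 2 * y i * bump (‖y‖ ^ 2) : ℝ) : ℂ) with hH
  have hp := integral_polar (n := n) (H := H)
    (h := fun x => ((‖zonal n F x‖ ^ 2 * (x : Euc n) i : ℝ) : ℂ))
    (k := fun r => ((r * bump (r ^ 2) : ℝ) : ℂ)) (by
      intro r hr x
      have hr' : r ≠ 0 := hr.ne'
      simp only [hH]
      rw [norm_smul, norm_eq_of_mem_sphere, mul_one, Real.norm_of_nonneg hr.le, zonal_apply,
        ← Complex.ofReal_mul]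
      congr 1
      simp only [PiLp.smul_apply, smul_eq_mul]
      rw [mul_right_comm r, mul_inv_cancel₀ hr', one_mul]
      ring)
  -- The homogeneous factor `y i` contributes one more power of `r`, hence `radialMass (n + 1)`.
  have hm : ∫ r in Set.Ioi (0 : ℝ), (r : ℂ) ^ n * ((r * bump (r ^ 2) : ℝ) : ℂ)
      = radialMass (n + 1) := by
    rw [radialMass, ← integral_complex_ofReal]
    congr 1
    ext r
    push_cast
    ring
  let R : Euc n ≃ₗᵢ[ℝ] Euc n := LinearIsometryEquiv.piLpCongrRight 2 fun j =>
    if j = i then LinearIsometryEquiv.neg ℝ else LinearIsometryEquiv.refl ℝ ℝ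
  have hR0 (y : Euc n) : R y 0 = y 0 := by
    simp [R, hi.symm]
  have hRi (y : Euc n) : R y i = -y i := by simp [R]
  have hinv : ∫ y, H y = -∫ y, H y := by
    rw [← integral_neg, ← R.measurePreserving.integral_comp R.toHomeomorph.measurableEmbedding]
    congr 1
    ext y
    simp only [hH, R.norm_map, hR0, hRi]
    push_cast
    ring
  have h0 : ∫ y, H y = 0 := self_eq_neg.1 hinv
  rw [h0, hm, eq_comm, mul_eq_zero, integral_complex_ofReal] at hp
  have hr : (radialMass (n + 1) : ℂ) ≠ 0 := by exact_mod_cast (radialMass_pos (n + 1)).ne'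
  exact_mod_cast hp.resolve_right hr

theorem moment_zonal {F : ℝ → ℂ} (hf : MemLp (zonal n F) 2 (surf n)) :
    moment (zonal n F) = EuclideanSpace.single 0
      (∫ x : Sph n, ‖zonal n F x‖ ^ 2 * (x : Euc n) 0 ∂surf n) := by
  have hint : Integrable (fun x : Sph n => ‖zonal n F x‖ ^ 2 • (x : Euc n)) (surf n) := by
    have h2 := hf.integrable_norm_pow (by norm_num)
    refine (h2.smul_bdd 1 continuous_subtype_val.aestronglyMeasurable ?_)
    exact Eventually.of_forall fun x => (norm_eq_of_mem_sphere x).le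
  have hco (i : Fin (n + 1)) : moment (zonal n F) i =
      ∫ x : Sph n, ‖zonal n F x‖ ^ 2 * (x : Euc n) i ∂surf n :=
    ((EuclideanSpace.proj i : Euc n →L[ℝ] ℝ).integral_comp_comm hint).symm
  ext i
  rw [hco]
  by_cases hi : i = 0
  · subst hi; simp
  · rw [integral_norm_sq_zonal_mul_coord F hi]
    simp [hi]

end Moment

/-! ### The Dirichlet form on Gegenbauer sums, its closure and Bessel's inequality -/

section Momentum

open Polynomial

variable {n : ℕ}

/-- The eigenvalue `l (l + 2λ)` of `-Δ*`. -/
def lbEigenvalue (n l : ℕ) : ℝ := l * (l + 2 * lam n)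

theorem lbInner_gegPoly (l : ℕ) (ψ : Sph n → ℂ) :
    lbInner (zonalPoly n (gegPoly (lam n) l)) ψ =
      lbEigenvalue n l * ∫ x, zonalPoly n (gegPoly (lam n) l) x * conj (ψ x) ∂surf n := by
  have h : laplaceBeltrami (zonalPoly n (gegPoly (lam n) l)) = fun x =>
      -((lbEigenvalue n l : ℂ) * zonalPoly n (gegPoly (lam n) l) x) := by
    rw [laplaceBeltrami_zonalPoly]
    change zonalPoly n (zonalLaplacian n _) = _
    rw [zonalLaplacian_gegPoly]
    ext x
    simp [zonalPoly, lbEigenvalue]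
  rw [lbInner, h, ← integral_const_mul, ← integral_neg]
  congr 1
  ext x
  ring

/-- A finite combination of zonal Gegenbauer polynomials. -/
def gegSum (n : ℕ) (c : ℕ → ℂ) (s : Finset ℕ) : Sph n → ℂ :=
  ∑ l ∈ s, c l • zonalPoly n (gegPoly (lam n) l)

theorem isC2_gegSum (c : ℕ → ℂ) (s : Finset ℕ) : IsC2 (gegSum n c s) :=
  (c2Submodule n).sum_mem fun l _ => (c2Submodule n).smul_mem (c l) (isC2_zonalPoly _)

theorem lbInner_gegSum_right {φ : Sph n → ℂ} (hφ : IsC2 φ) (c : ℕ → ℂ) (s : Finset ℕ) :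
    lbInner φ (gegSum n c s) = ∑ l ∈ s, conj (c l) * lbInner φ (zonalPoly n (gegPoly (lam n) l)) := by
  induction s using Finset.induction_on with
  | empty => simp [gegSum, lbInner]
  | insert l s hl ih =>
    have h : gegSum n c (insert l s) = c l • zonalPoly n (gegPoly (lam n) l) + gegSum n c s := by
      rw [gegSum, Finset.sum_insert hl, gegSum]
    rw [h, lbInner_add_right hφ ((c2Submodule n).smul_mem (c l) (isC2_zonalPoly _))
      (isC2_gegSum c s), lbInner_smul_right, ih, Finset.sum_insert hl]

theorem lbInner_gegPoly_gegPoly (hn : 2 ≤ n) (l m : ℕ) :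
    lbInner (zonalPoly n (gegPoly (lam n) l)) (zonalPoly n (gegPoly (lam n) m)) =
      if l = m then ((lbEigenvalue n l * gegNormSq n l : ℝ) : ℂ) else 0 := by
  rw [lbInner_gegPoly, integral_zonalPoly_mul_conj]
  split_ifs with h
  · subst h
    rw [gegNormSq]
    push_cast
    rfl
  · rw [zonalIntegral_gegPoly_mul_of_ne hn h]
    simp

theorem lbForm_gegSum (hn : 2 ≤ n) (c : ℕ → ℂ) (s : Finset ℕ) :
    lbForm (gegSum n c s) =
      ((∑ l ∈ s, lbEigenvalue n l * gegNormSq n l * ‖c l‖ ^ 2 : ℝ) : ℂ) := by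
  rw [lbForm_eq_lbInner, lbInner_gegSum_right (isC2_gegSum c s), Complex.ofReal_sum]
  refine Finset.sum_congr rfl fun m hm => ?_
  rw [← lbInner_conj_symm (isC2_zonalPoly _) (isC2_gegSum c s),
    lbInner_gegSum_right (isC2_zonalPoly _)]
  simp only [lbInner_gegPoly_gegPoly hn, mul_ite, mul_zero, Finset.sum_ite_eq, hm, if_true, map_mul,
    Complex.conj_conj, Complex.conj_ofReal]
  have := Complex.mul_conj' (c m)
  push_cast
  rw [← this]
  ring

theorem tendsto_lbForm_gegSum_sub (hn : 2 ≤ n) {a : ℕ → ℂ}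
    (hs : Summable fun l => lbEigenvalue n l * gegNormSq n l * ‖a l‖ ^ 2) :
    Tendsto (fun p : ℕ × ℕ => lbForm (gegSum n a (Finset.range p.1) -
      gegSum n a (Finset.range p.2))) atTop (𝓝 0) := by
  set t : ℕ → ℝ := fun l => lbEigenvalue n l * gegNormSq n l * ‖a l‖ ^ 2 with ht
  have hdiff {p q : ℕ} (hqp : q ≤ p) : gegSum n a (Finset.range p) - gegSum n a (Finset.range q) =
      gegSum n a (Finset.Ico q p) := by
    rw [gegSum, gegSum, gegSum, Finset.sum_Ico_eq_sub _ hqp]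
  have hneg (s : Finset ℕ) : -gegSum n a s = gegSum n (-a) s := by
    simp [gegSum]
  -- The difference of two partial sums is, up to sign, a block of the expansion, and the form is
  -- even and nonnegative; hence the absolute value covers both orders of `p` and `q`.
  have hval (p q : ℕ) : lbForm (gegSum n a (Finset.range p) - gegSum n a (Finset.range q)) =
      ((|∑ l ∈ Finset.range p, t l - ∑ l ∈ Finset.range q, t l| : ℝ) : ℂ) := by
    have ht0 (l : ℕ) : 0 ≤ t l := by
      have h1 := lam_pos hn
      have h2 := gegNormSq_pos hn l
      simp only [ht, lbEigenvalue]
      positivity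
    rcases le_total q p with h | h
    · rw [hdiff h, lbForm_gegSum hn, ← Finset.sum_Ico_eq_sub _ h,
        abs_of_nonneg (Finset.sum_nonneg fun l _ => ht0 l)]
    · rw [← neg_sub, hdiff h, hneg, lbForm_gegSum hn, abs_sub_comm, ← Finset.sum_Ico_eq_sub _ h,
        abs_of_nonneg (Finset.sum_nonneg fun l _ => ht0 l)]
      simp [ht]
  simp only [hval]
  have hlim := hs.hasSum.tendsto_sum_nat
  have h1 : Tendsto (fun p : ℕ × ℕ => ∑ l ∈ Finset.range p.1, t l) atTop (𝓝 (∑' l, t l)) :=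
    hlim.comp (by rw [← prod_atTop_atTop_eq]; exact tendsto_fst)
  have h2 : Tendsto (fun p : ℕ × ℕ => ∑ l ∈ Finset.range p.2, t l) atTop (𝓝 (∑' l, t l)) :=
    hlim.comp (by rw [← prod_atTop_atTop_eq]; exact tendsto_snd)
  have h3 := (h1.sub h2).abs
  rw [sub_self, abs_zero] at h3
  exact_mod_cast (Complex.continuous_ofReal.tendsto 0).comp h3

theorem tendsto_lbForm_gegSum (hn : 2 ≤ n) {a : ℕ → ℂ}
    (hs : Summable fun l => lbEigenvalue n l * gegNormSq n l * ‖a l‖ ^ 2) :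
    Tendsto (fun N => lbForm (gegSum n a (Finset.range N))) atTop
      (𝓝 ((∑' l, lbEigenvalue n l * gegNormSq n l * ‖a l‖ ^ 2 : ℝ) : ℂ)) := by
  simp only [lbForm_gegSum hn]
  exact (Complex.continuous_ofReal.tendsto _).comp hs.hasSum.tendsto_sum_nat

/-- Partial sums of the expansion realize the value; closability forces every other approximating
sequence to the same limit. -/
theorem hasLBForm_iff (hn : 2 ≤ n) {f : Sph n → ℂ} (hf : MemLp f 2 (surf n)) {a : ℕ → ℂ}
    (ha : Tendsto (fun N => eLpNorm (gegSum n a (Finset.range N) - f) 2 (surf n)) atTop (𝓝 0))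
    (hs : Summable fun l => lbEigenvalue n l * gegNormSq n l * ‖a l‖ ^ 2) (q : ℂ) :
    HasLBForm f q ↔ q = ((∑' l, lbEigenvalue n l * gegNormSq n l * ‖a l‖ ^ 2 : ℝ) : ℂ) := by
  constructor
  · rintro ⟨φ, hφ, hφf, hφc, hq⟩
    exact tendsto_nhds_unique hq (tendsto_lbForm_of_tendsto hf.aestronglyMeasurable hφ
      (fun N => isC2_gegSum a _) hφf ha hφc (tendsto_lbForm_gegSum_sub hn hs)
      (tendsto_lbForm_gegSum hn hs))
  · rintro rfl
    exact ⟨_, fun N => isC2_gegSum a _, ha, tendsto_lbForm_gegSum_sub hn hs,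
      tendsto_lbForm_gegSum hn hs⟩

theorem lbInner_sub_right {φ ψ₁ ψ₂ : Sph n → ℂ} (hφ : IsC2 φ) (h₁ : IsC2 ψ₁) (h₂ : IsC2 ψ₂) :
    lbInner φ (ψ₁ - ψ₂) = lbInner φ ψ₁ - lbInner φ ψ₂ := by
  have h := lbInner_add_right hφ (h₁.sub h₂) h₂
  rw [sub_add_cancel] at h
  rw [h, add_sub_cancel_right]

/-- Bessel's inequality for the Dirichlet form. -/
theorem summable_of_isC2 (hn : 2 ≤ n) {f : Sph n → ℂ} (hf : IsC2 f) {a : ℕ → ℂ}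
    (ha : ∀ l, ∫ x, f x * zonalPoly n (gegPoly (lam n) l) x ∂surf n = gegNormSq n l * a l) :
    Summable fun l => lbEigenvalue n l * gegNormSq n l * ‖a l‖ ^ 2 := by
  have hnn (l : ℕ) : 0 ≤ lbEigenvalue n l * gegNormSq n l * ‖a l‖ ^ 2 := by
    have h1 := lam_pos hn
    have h2 := gegNormSq_pos hn l
    simp only [lbEigenvalue]
    positivity
  refine summable_of_sum_range_le (c := (lbForm f).re) hnn fun N => ?_
  set g := gegSum n a (Finset.range N) with hg
  have hgC : IsC2 g := isC2_gegSum _ _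
  set S : ℝ := ∑ l ∈ Finset.range N, lbEigenvalue n l * gegNormSq n l * ‖a l‖ ^ 2 with hS
  have hfz (l : ℕ) : lbInner f (zonalPoly n (gegPoly (lam n) l)) =
      lbEigenvalue n l * (gegNormSq n l * a l) := by
    rw [← lbInner_conj_symm (isC2_zonalPoly _) hf, lbInner_gegPoly, map_mul, Complex.conj_ofReal,
      ← ha, ← integral_conj]
    congr 2
    ext x
    simp [zonalPoly, mul_comm]
  have hfg : lbInner f g = (S : ℂ) := by
    rw [hg, lbInner_gegSum_right hf, hS, Complex.ofReal_sum]
    refine Finset.sum_congr rfl fun l _ => ?_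
    rw [hfz]
    have := Complex.mul_conj' (a l)
    push_cast
    rw [← this]
    ring
  have hgf : lbInner g f = (S : ℂ) := by
    rw [← lbInner_conj_symm hf hgC, hfg, Complex.conj_ofReal]
  have hgg : lbInner g g = (S : ℂ) := lbForm_gegSum hn _ _
  -- Since `f - g` is orthogonal to `g` for the form, its energy is the energy of `f` minus `S`;
  -- nonnegativity is the required bound.
  have h := lbInner_self_nonneg (hf.sub hgC)
  have e1 : lbInner (f - g) f = lbInner f f - S := by
    rw [← lbInner_conj_symm hf (hf.sub hgC), lbInner_sub_right hf hf hgC, map_sub, hfg,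
      lbInner_conj_symm hf hf, Complex.conj_ofReal]
  have e2 : lbInner (f - g) g = 0 := by
    rw [← lbInner_conj_symm hgC (hf.sub hgC), lbInner_sub_right hgC hf hgC, hgf, hgg]
    simp
  rw [lbInner_sub_right (hf.sub hgC) hf hgC, e1, e2, sub_zero, Complex.sub_re,
    Complex.ofReal_re] at h
  rw [lbForm_eq_lbInner]
  linarith

end Momentum

end SphereVariance

end

/-! ### Assembly of the theorem -/

open SphereVariance in
theorem mainTheorem5 (n : ℕ) (hn : 2 ≤ n) (F : ℝ → ℂ)
    (hF : AEStronglyMeasurable F (volume.restrict (Set.Icc (-1 : ℝ) 1)))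
    (f : SphereVariance.Sph n → ℂ) (hfF : f = SphereVariance.zonal n F)
    (hf : MemLp f 2 (SphereVariance.surf n))
    (hf0 : ¬ f =ᵐ[SphereVariance.surf n] 0)
    (a : ℕ → ℂ) (ha : a = SphereVariance.gegenbauerCoeff n F) :
    -- the Gegenbauer expansion of `f` converges to `f` in `L²(S^n)`
    Tendsto (fun N : ℕ => eLpNorm (f - SphereVariance.zonal n (fun t =>
        ∑ l ∈ Finset.range N, a l * (SphereVariance.gegenbauer (SphereVariance.lam n) l t : ℂ)))
        2 (SphereVariance.surf n)) atTop (𝓝 0) ∧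
    -- the series for the space variance converge, and the first of them is positive
    Summable (SphereVariance.normTerm n a) ∧
    0 < ∑' l, SphereVariance.normTerm n a l ∧
    Summable (SphereVariance.crossTerm n a) ∧
    -- the space variance
    (SphereVariance.moment f ≠ 0 →
      ∑' l, SphereVariance.crossTerm n a l ≠ 0 ∧
      ((SphereVariance.varS f : ℝ) : ℂ) =
        (((∑' l, SphereVariance.normTerm n a l : ℝ) : ℂ) /
          ∑' l, SphereVariance.crossTerm n a l) ^ 2 - 1) ∧
    -- the momentum variance, whenever its series converges
    (Summable (fun l : ℕ => SphereVariance.momentumTerm n a (l + 1)) →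
      ∀ v : ℂ, SphereVariance.HasVarM f v ↔
        v = (((∑' l : ℕ, SphereVariance.momentumTerm n a (l + 1)) /
          ∑' l, SphereVariance.normTerm n a l : ℝ) : ℂ)) ∧
    -- the classical momentum variance of a function of class `C²`, where the series converges
    (SphereVariance.IsC2 f →
      Summable (fun l : ℕ => SphereVariance.momentumTerm n a (l + 1)) ∧
      SphereVariance.varM f =
        (((∑' l : ℕ, SphereVariance.momentumTerm n a (l + 1)) /
          ∑' l, SphereVariance.normTerm n a l : ℝ) : ℂ)) := by
  subst hfF ha
  set f := zonal n F with hfdef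
  set a := gegenbauerCoeff n F with hadef
  have hFm := aestronglyMeasurable_coordMeasure hn hF
  have hF2 : MemLp F 2 (coordMeasure n) := by
    rw [coordMeasure, memLp_map_measure_iff hFm continuous_coord.aemeasurable, ← zonal_eq_comp]
    exact hf
  have hmap {E : Type} [NormedAddCommGroup E] [NormedSpace ℝ E] {g : ℝ → E}
      (hg : AEStronglyMeasurable g (coordMeasure n)) :
      ∫ t, g t ∂coordMeasure n = ∫ x : Sph n, g ((x : Euc n) 0) ∂surf n :=
    integral_map continuous_coord.aemeasurable hg
  have hS := sphMass_pos n
  have hSC : (sphMass n : ℂ) ≠ 0 := by exact_mod_cast hS.ne'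
  have hnorm : ∫ t, ‖F t‖ ^ 2 ∂coordMeasure n = ∫ x, ‖f x‖ ^ 2 ∂surf n := by
    rw [hmap (g := fun t => ‖F t‖ ^ 2) (hFm.norm.pow 2)]
    simp [hfdef, zonal_apply]
  have hcoord : ∫ t, t * ‖F t‖ ^ 2 ∂coordMeasure n =
      ∫ x : Sph n, ‖f x‖ ^ 2 * (x : Euc n) 0 ∂surf n := by
    rw [hmap (g := fun t => t * ‖F t‖ ^ 2)
      (continuous_id.aestronglyMeasurable.mul (hFm.norm.pow 2))]
    simp [hfdef, zonal_apply, mul_comm]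
  -- the expansion
  have hexp : Tendsto (fun N : ℕ => eLpNorm (f - zonal n (fun t =>
      ∑ l ∈ Finset.range N, a l * (gegenbauer (lam n) l t : ℂ))) 2 (surf n)) atTop (𝓝 0) := by
    refine (tendsto_gegenbauer_expansion hn hF2).congr fun N => ?_
    have hm : AEStronglyMeasurable (F - fun t => ∑ l ∈ Finset.range N,
        gegenbauerCoeff n F l * (gegenbauer (lam n) l t : ℂ)) (coordMeasure n) := by
      refine hFm.sub (Continuous.aestronglyMeasurable ?_)
      simp only [gegenbauer_eq_eval]
      fun_prop
    rw [coordMeasure, eLpNorm_map_measure hm continuous_coord.aemeasurable, hfdef, zonal_eq_comp,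
      zonal_eq_comp]
    rfl
  have hgs (N : ℕ) : zonal n (fun t => ∑ l ∈ Finset.range N, a l * (gegenbauer (lam n) l t : ℂ)) =
      gegSum n a (Finset.range N) := by
    ext x
    simp [zonal_apply, gegSum, zonalPoly, gegenbauer_eq_eval]
  have hexp' : Tendsto (fun N => eLpNorm (gegSum n a (Finset.range N) - f) 2 (surf n))
      atTop (𝓝 0) := by
    refine hexp.congr fun N => ?_
    rw [hgs, eLpNorm_sub_comm]
  -- the norm
  have hA : HasSum (normTerm n a) ((∫ x, ‖f x‖ ^ 2 ∂surf n) / sphMass n) := by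
    rw [← hnorm]
    have h := (hasSum_gegNormSq_mul hn hF2).div_const (sphMass n)
    have e (l : ℕ) : gegNormSq n l * ‖a l‖ ^ 2 / sphMass n = normTerm n a l := by
      rw [gegNormSq_eq hn, normTerm]
      field_simp
    simp only [← hadef, e] at h
    exact h
  have hApos : 0 < ∫ x, ‖f x‖ ^ 2 ∂surf n := by
    have hi : Integrable (fun x => ‖f x‖ ^ 2) (surf n) := hf.integrable_norm_pow (by norm_num)
    refine lt_of_le_of_ne (integral_nonneg fun x => by positivity) fun h => hf0 ?_
    have h' := (integral_eq_zero_iff_of_nonneg (fun x => by positivity) hi).1 h.symm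
    filter_upwards [h'] with x hx
    simpa using hx
  -- the first moment
  have hD : HasSum (crossTerm n a)
      ((∫ x : Sph n, ‖f x‖ ^ 2 * (x : Euc n) 0 ∂surf n : ℝ) / (sphMass n : ℂ)) := by
    rw [← hcoord]
    have h := (hasSum_gegCross_mul hn hF2).div_const (sphMass n : ℂ)
    have hl := lam_pos hn
    have e (l : ℕ) : (gegCross n l : ℂ) * (conj (a l) * a (l + 1) + a l * conj (a (l + 1))) /
        (sphMass n : ℂ) = crossTerm n a l := by
      rw [gegCross_eq hn, crossTerm]
      push_cast
      field_simp
    simp only [← hadef, e] at h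
    exact h
  -- the momentum
  have hM (l : ℕ) : lbEigenvalue n l * gegNormSq n l * ‖a l‖ ^ 2 =
      sphMass n * momentumTerm n a l := by
    rw [gegNormSq_eq hn, lbEigenvalue, momentumTerm]
    ring
  -- The term of degree zero has eigenvalue zero, so starting the series at degree one affects
  -- neither summability nor the sum.
  have hsumM : Summable (fun l => momentumTerm n a (l + 1)) ↔
      Summable fun l => lbEigenvalue n l * gegNormSq n l * ‖a l‖ ^ 2 := by
    simp only [hM]
    rw [summable_mul_left_iff hS.ne', summable_nat_add_iff 1]
  have htsum (h : Summable (fun l => momentumTerm n a (l + 1))) :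
      ∑' l, lbEigenvalue n l * gegNormSq n l * ‖a l‖ ^ 2 =
        sphMass n * ∑' l, momentumTerm n a (l + 1) := by
    simp only [hM]
    rw [tsum_mul_left, ((summable_nat_add_iff 1).1 h).tsum_eq_zero_add]
    simp [momentumTerm]
  have hvar (h : Summable (fun l => momentumTerm n a (l + 1))) (v : ℂ) : HasVarM f v ↔
      v = (((∑' l : ℕ, momentumTerm n a (l + 1)) / ∑' l, normTerm n a l : ℝ) : ℂ) := by
    have hq := hasLBForm_iff hn hf hexp' (hsumM.1 h)
    have e : (((∑' l : ℕ, momentumTerm n a (l + 1)) / ∑' l, normTerm n a l : ℝ) : ℂ) =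
        ((∑' l, lbEigenvalue n l * gegNormSq n l * ‖a l‖ ^ 2 : ℝ) : ℂ) /
          ((∫ x, ‖f x‖ ^ 2 ∂surf n : ℝ) : ℂ) := by
      rw [← Complex.ofReal_div, htsum h, hA.tsum_eq]
      congr 1
      field_simp
    rw [e]
    constructor
    · rintro ⟨q, hfq, rfl⟩
      rw [(hq q).1 hfq]
    · rintro rfl
      exact ⟨_, (hq _).2 rfl, rfl⟩
  refine ⟨hexp, hA.summable, ?_, hD.summable, fun hm => ?_, hvar, fun hC => ?_⟩
  · rw [hA.tsum_eq]
    positivity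
  · have hmo := moment_zonal hf
    rw [← hfdef] at hmo
    set m : ℝ := ∫ x : Sph n, ‖f x‖ ^ 2 * (x : Euc n) 0 ∂surf n with hmdef
    have hm0 : m ≠ 0 := by
      rintro h0
      rw [h0] at hmo
      exact hm (by rw [hmo]; simp)
    have hmC : (m : ℂ) ≠ 0 := by exact_mod_cast hm0
    refine ⟨by rw [hD.tsum_eq]; exact div_ne_zero hmC hSC, ?_⟩
    -- The norm of the moment is `|m|`; squaring removes the sign, and the two factors of `sphMass
    -- n` cancel.
    rw [varS, hD.tsum_eq, hA.tsum_eq, hmo, PiLp.norm_single, Real.norm_eq_abs, div_pow,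
      sq_abs]
    push_cast
    field_simp
  · have hs : Summable (fun l => momentumTerm n a (l + 1)) := by
      rw [hsumM]
      refine summable_of_isC2 hn hC fun l => ?_
      rw [hadef, ← integral_mul_gegPoly hn,
        hmap (g := fun t => F t * (((gegPoly (lam n) l).eval t : ℝ) : ℂ)) (hFm.mul (memLp_polynomial _).aestronglyMeasurable)]
      simp [hfdef, zonal_apply, zonalPoly]
    -- The constant sequence `f` shows that the classical value is a value of the closed form, and
    -- uniqueness identifies it.
    exact ⟨hs, (hvar hs _).1 hC.hasVarM⟩
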